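/- **Conventions.** Let $k$ be a field, $H$ a Hopf algebra over $k$ with antipode $S$; $\otimes=\otimes_k$, $M^*={\rm Hom}_k(M,k)$. A *partial (right) $H$-comodule* is a vector space $M$ with a linear map $\rho:M\to M\otimes H$, $\rho(m)=m^{[0]}\otimes m^{[1]}$, such that for all $m\in M$: $m^{[0]}\epsilon(m^{[1]})=m$; $m^{[0][0]}\otimes m^{[0][1]}{}_{(1)}\otimes m^{[0][1]}{}_{(2)}S(m^{[1]})=m^{[0][0][0]}\otimes m^{[0][0][1]}\otimes m^{[0][1]}S(m^{[1]})$; and $m^{[0][0]}\otimes m^{[0][1]}S(m^{[1]}{}_{(1)})\otimes m^{[1]}{}_{(2)}=m^{[0][0][0]}\otimes m^{[0][0][1]}S(m^{[0][1]})\otimes m^{[1]}$. A morphism $(M,\rho)\to(N,\sigma)$ is a linear map $f$ with $\sigma f=(f\otimes I)\rho$. This defines the category ${\sf Mod}^H_{par}$; ${\sf Mod}^C$ is the usual category of right comodules over a coalgebra $C$. A linear map $\omega:C\to H$ from a coalgebra $C$ is a *partial corepresentation* if for all $c\in C$: $\epsilon_H(\omega(c))=\epsilon_C(c)$; $\omega(c_{(1)})_{(1)}\otimes\omega(c_{(1)})_{(2)}S(\omega(c_{(2)}))=\omega(c_{(1)})\otimes\omega(c_{(2)})S(\omega(c_{(3)}))$;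 and $\omega(c_{(1)})S(\omega(c_{(2)})_{(1)})\otimes\omega(c_{(2)})_{(2)}=\omega(c_{(1)})S(\omega(c_{(2)}))\otimes\omega(c_{(3)})$. Let $(C(H),p)$ be the cofree coalgebra over the vector space $H$. The *universal corep-coalgebra* $H^{par}\subseteq C(H)$ is the sum of all subcoalgebras $X\subseteq C(H)$ such that $p|_X:X\to H$ is a partial corepresentation; the restriction $H^{par}\to H$ of $p$ is again denoted by $p$. A (possibly non-unital) ring $R$ is *firm* if multiplication induces an isomorphism $R\otimes_RR\to R$, and a left $R$-module $M$ is *firm* if the action induces an isomorphism $R\otimes_RM\to M$. A comodule (respectively partial comodule) $M$ is *firmly projective* if there are a firm subring $R$ of its ring of comodule (respectively partial comodule) endomorphisms and a ring morphism $\phi:R\to M\otimes M^*$ such that, for $\phi(r)=\sum_i e_i\otimes f_i$, the action $r\cdot m=\sum_i f_i(m)e_i$ is the evaluation $r(m)$, and $M$ is a firm left $R$-module. **Theorem.** (i) For every $H^{par}$-comodule $(M,\hat\rho)$ the pair $(M,\rho)$ with $\rho=(I\otimes p)\circ\hat\rho$ is a partial $H$-comodule. Together with the identity on underlying linear maps this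 defines a fully faithful functor $\Gamma:{\sf Mod}^{H^{par}}\to{\sf Mod}^H_{par}$. (ii) $\Gamma$ maps firmly projective $H^{par}$-comodules to firmly projective partial $H$-comodules, and restricts to an isomorphism of categories between the full subcategories of firmly projective $H^{par}$-comodules and of firmly projective partial $H$-comodules. (iii) $\Gamma$ restricts to an isomorphism of categories ${\sf Mod}^{H^{par}}_{fd}\to{\sf Mod}^H_{par,fd}$ between the full subcategories of finite-dimensional objects. Moreover $H^{par}$ is the coalgebra reconstructed by the Tannakian formalism (i.e. the coend) from the fibre functor $U:{\sf Mod}^H_{par,fd}\to{\sf Vect}$: every finite-dimensional partial $H$-comodule $(N,\rho_N)$ carries an $H^{par}$-comodule structure $\delta_N:N\to N\otimes H^{par}$ with $(I\otimes p)\delta_N=\rho_N$, the maps $\delta_N$ are natural in $N$, and for every vector space $V$ and every natural transformation $\tau:U\to U\otimes V$ there is exactly one linear map $g:H^{par}\to V$ with $\tau_N=(I_N\otimes g)\circ\delta_N$ for all $N$. -/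

import Mathlib

open TensorProduct CategoryTheory

universe u v w w'

namespace PartialComodule

noncomputable section

section Coalgebras

variable (k : Type u) [Field k]

/-- A subcoalgebra of a coalgebra `C` over a field: a subspace `X` with `Δ(X) ⊆ X ⊗ X`. -/
structure Subcoalgebra (C : Type v) [AddCommGroup C] [Module k C] [Coalgebra k C] where
  carrier : Submodule k C
  comul_mem : ∀ x ∈ carrier, Coalgebra.comul (R := k) x ∈
    LinearMap.range (TensorProduct.map carrier.subtype carrier.subtype)

variable {k}

namespace Subcoalgebra

variable {C : Type v} [AddCommGroup C] [Module k C] [Coalgebra k C] (X : Subcoalgebra k C)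

theorem map_subtype_injective :
    Function.Injective (TensorProduct.map X.carrier.subtype X.carrier.subtype) :=
  TensorProduct.map_injective_of_flat_flat _ _ X.carrier.subtype_injective
    X.carrier.subtype_injective

/-- The restriction of the comultiplication of `C` to a map `X → X ⊗ X`. -/
def comulRestrict : X.carrier →ₗ[k] X.carrier ⊗[k] X.carrier :=
  (LinearEquiv.ofInjective _ X.map_subtype_injective).symm.toLinearMap ∘ₗ
    LinearMap.codRestrict
      (LinearMap.range (TensorProduct.map X.carrier.subtype X.carrier.subtype))
      (Coalgebra.comul (R := k) ∘ₗ X.carrier.subtype)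
      (fun x => X.comul_mem x.1 x.2)

theorem map_comulRestrict :
    TensorProduct.map X.carrier.subtype X.carrier.subtype ∘ₗ X.comulRestrict =
      Coalgebra.comul (R := k) ∘ₗ X.carrier.subtype := by
  ext x
  have h := LinearEquiv.apply_symm_apply (LinearEquiv.ofInjective _ X.map_subtype_injective)
    (LinearMap.codRestrict
      (LinearMap.range (TensorProduct.map X.carrier.subtype X.carrier.subtype))
      (Coalgebra.comul (R := k) ∘ₗ X.carrier.subtype)
      (fun x => X.comul_mem x.1 x.2) x)
  exact congrArg Subtype.val h

theorem map_comulRestrict_apply (x : X.carrier) :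
    TensorProduct.map X.carrier.subtype X.carrier.subtype (X.comulRestrict x) =
      Coalgebra.comul (R := k) (x : C) :=
  LinearMap.congr_fun X.map_comulRestrict x

/-- A subcoalgebra is a coalgebra, with the restricted comultiplication and counit. -/
instance instCoalgebra : Coalgebra k X.carrier where
  comul := X.comulRestrict
  counit := Coalgebra.counit (R := k) ∘ₗ X.carrier.subtype
  coassoc := by
    have hinj : Function.Injective (TensorProduct.map X.carrier.subtype
        (TensorProduct.map X.carrier.subtype X.carrier.subtype)) :=
      TensorProduct.map_injective_of_flat_flat _ _ X.carrier.subtype_injective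
        X.map_subtype_injective
    have h1 : ∀ t, TensorProduct.map X.carrier.subtype
        (TensorProduct.map X.carrier.subtype X.carrier.subtype)
          (TensorProduct.assoc k _ _ _ (X.comulRestrict.rTensor _ t)) =
        TensorProduct.assoc k C C C ((Coalgebra.comul (R := k)).rTensor C
          (TensorProduct.map X.carrier.subtype X.carrier.subtype t)) := by
      intro t
      induction t with
      | zero => simp
      | add a b ha hb => simp only [map_add, ha, hb]
      | tmul x y =>
        simp only [LinearMap.rTensor_tmul, TensorProduct.map_tmul, Submodule.subtype_apply,
          ← map_comulRestrict_apply]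
        generalize X.comulRestrict x = s
        induction s with
        | zero => simp
        | add a b ha hb => simp only [map_add, TensorProduct.add_tmul, ha, hb]
        | tmul a b => simp
    have h2 : ∀ t, TensorProduct.map X.carrier.subtype
        (TensorProduct.map X.carrier.subtype X.carrier.subtype) (X.comulRestrict.lTensor _ t) =
        (Coalgebra.comul (R := k)).lTensor C
          (TensorProduct.map X.carrier.subtype X.carrier.subtype t) := by
      intro t
      induction t with
      | zero => simp
      | add a b ha hb => simp only [map_add, ha, hb]
      | tmul x y => simp [map_comulRestrict_apply]
    ext x
    apply hinj
    simp only [LinearMap.comp_apply, LinearEquiv.coe_coe, h1, h2, map_comulRestrict_apply,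
      Coalgebra.coassoc_apply]
  rTensor_counit_comp_comul := by
    have hinj : Function.Injective (X.carrier.subtype.lTensor k) :=
      Module.Flat.lTensor_preserves_injective_linearMap _ X.carrier.subtype_injective
    have h : ∀ t, X.carrier.subtype.lTensor k
        ((Coalgebra.counit (R := k) ∘ₗ X.carrier.subtype).rTensor _ t) =
        (Coalgebra.counit (R := k)).rTensor C
          (TensorProduct.map X.carrier.subtype X.carrier.subtype t) := by
      intro t
      induction t with
      | zero => simp
      | add a b ha hb => simp only [map_add, ha, hb]
      | tmul x y => simp
    ext x
    apply hinj
    simp only [LinearMap.comp_apply, h, map_comulRestrict_apply, Coalgebra.rTensor_counit_comul]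
    simp
  lTensor_counit_comp_comul := by
    have hinj : Function.Injective (X.carrier.subtype.rTensor k) :=
      Module.Flat.rTensor_preserves_injective_linearMap _ X.carrier.subtype_injective
    have h : ∀ t, X.carrier.subtype.rTensor k
        ((Coalgebra.counit (R := k) ∘ₗ X.carrier.subtype).lTensor _ t) =
        (Coalgebra.counit (R := k)).lTensor C
          (TensorProduct.map X.carrier.subtype X.carrier.subtype t) := by
      intro t
      induction t with
      | zero => simp
      | add a b ha hb => simp only [map_add, ha, hb]
      | tmul x y => simp
    ext x
    apply hinj
    simp only [LinearMap.comp_apply, h, map_comulRestrict_apply, Coalgebra.lTensor_counit_comul]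
    simp

/-- The inclusion of a subcoalgebra is a morphism of coalgebras. -/
def incl : X.carrier →ₗc[k] C where
  toLinearMap := X.carrier.subtype
  counit_comp := rfl
  map_comp_comul := X.map_comulRestrict

/-- The sum of a family of subcoalgebras. -/
def sum (S : Set (Subcoalgebra k C)) : Subcoalgebra k C where
  carrier := ⨆ X ∈ S, X.carrier
  comul_mem := by
    intro x hx
    suffices h : (⨆ X ∈ S, X.carrier) ≤ (LinearMap.range (TensorProduct.map
        (⨆ X ∈ S, X.carrier).subtype (⨆ X ∈ S, X.carrier).subtype)).comap
          (Coalgebra.comul (R := k)) from h hx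
    refine iSup₂_le fun X hX y hy => ?_
    have hle : X.carrier ≤ ⨆ X ∈ S, X.carrier := le_iSup₂_of_le X hX le_rfl
    obtain ⟨t, ht⟩ := X.comul_mem y hy
    refine ⟨TensorProduct.map (Submodule.inclusion hle) (Submodule.inclusion hle) t, ?_⟩
    rw [← ht, ← LinearMap.comp_apply, ← TensorProduct.map_comp]
    rfl

/-- The subspace spanned by the entries of a finite matrix `c` with `Δ(c j i) = ∑ c j l ⊗ c l i`
is a subcoalgebra. -/
def ofMatrix {r : ℕ} (c : Fin r → Fin r → C)
    (hc : ∀ j i, Coalgebra.comul (R := k) (c j i) = ∑ l, c j l ⊗ₜ[k] c l i) :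
    Subcoalgebra k C where
  carrier := Submodule.span k (Set.range fun q : Fin r × Fin r => c q.1 q.2)
  comul_mem := by
    intro x hx
    induction hx using Submodule.span_induction with
    | mem x hx =>
      obtain ⟨⟨j, i⟩, rfl⟩ := hx
      have hm : ∀ a b, c a b ∈ Submodule.span k (Set.range fun q : Fin r × Fin r => c q.1 q.2) :=
        fun a b => Submodule.subset_span ⟨(a, b), rfl⟩
      refine ⟨∑ l, (⟨c j l, hm j l⟩ : Submodule.span k _) ⊗ₜ[k] ⟨c l i, hm l i⟩, ?_⟩
      simp [hc]
    | zero => simp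
    | add x y _ _ hx hy => rw [map_add]; exact add_mem hx hy
    | smul a x _ hx => rw [map_smul]; exact Submodule.smul_mem _ a hx

/-- Every element of a coalgebra over a field lies in a finite-dimensional left coideal. -/
theorem exists_finite_left_coideal (x : C) : ∃ N : Submodule k C, FiniteDimensional k N ∧
    x ∈ N ∧ ∀ y ∈ N, Coalgebra.comul (R := k) y ∈ LinearMap.range (N.subtype.lTensor C) := by
  let b := Module.Basis.ofVectorSpace k C
  obtain ⟨c, hc⟩ := TensorProduct.eq_repr_basis_left b (Coalgebra.comul (R := k) x)
  have hmem : ∀ i ∈ c.support, c i ∈ Submodule.span k (c '' c.support) :=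
    fun i hi => Submodule.subset_span ⟨i, hi, rfl⟩
  refine ⟨Submodule.span k (c '' c.support),
    FiniteDimensional.span_of_finite k (c.support.finite_toSet.image c), ?_, ?_⟩
  · have h := Coalgebra.rTensor_counit_comul (R := k) x
    rw [← hc, Finsupp.sum, map_sum] at h
    have h' := congrArg (TensorProduct.lid k C) h
    simp only [map_sum, LinearMap.rTensor_tmul, TensorProduct.lid_tmul, one_smul] at h'
    rw [← h']
    exact sum_mem fun i hi => Submodule.smul_mem _ _ (hmem i hi)
  · intro y hy
    induction hy using Submodule.span_induction with
    | mem y hy =>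
      obtain ⟨j, hj, rfl⟩ := hy
      have h := Coalgebra.coassoc_apply (R := k) x
      rw [← hc, Finsupp.sum] at h
      have h' := congrArg (TensorProduct.lid k (C ⊗[k] C))
        (congrArg ((b.coord j).rTensor (C ⊗[k] C)) h)
      simp only [map_sum, LinearMap.rTensor_tmul, LinearMap.lTensor_tmul,
        TensorProduct.lid_tmul, Module.Basis.coord_apply, Module.Basis.repr_self] at h'
      have e1 : ∑ i ∈ c.support, (Finsupp.single i (1 : k)) j • Coalgebra.comul (R := k) (c i) =
          Coalgebra.comul (R := k) (c j) := by
        rw [Finset.sum_eq_single j]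
        · simp
        · intro i _ hij
          simp [Finsupp.single_eq_of_ne' hij]
        · intro h; exact absurd hj h
      rw [e1] at h'
      rw [← h']
      refine sum_mem fun i hi => ?_
      generalize Coalgebra.comul (R := k) (b i) = t
      induction t with
      | zero => simp
      | add p q hp hq =>
        rw [TensorProduct.add_tmul, map_add, map_add, map_add]; exact add_mem hp hq
      | tmul p q =>
        refine ⟨(b.repr p j • q) ⊗ₜ ⟨c i, hmem i hi⟩, ?_⟩
        simp [TensorProduct.smul_tmul']
    | zero => simp
    | add x y _ _ hx hy => rw [map_add]; exact add_mem hx hy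
    | smul a x _ hx => rw [map_smul]; exact Submodule.smul_mem _ a hx

/-- The fundamental theorem of coalgebras: every element of a coalgebra over a field lies in a
finite-dimensional subcoalgebra. -/
theorem exists_finite (x : C) :
    ∃ X : Subcoalgebra k C, FiniteDimensional k X.carrier ∧ x ∈ X.carrier := by
  obtain ⟨N, hN, hxN, hΔ⟩ := exists_finite_left_coideal (k := k) x
  let n := Module.finBasis k N
  have hrep : ∀ j, ∃ c : Fin (Module.finrank k N) → C,
      Coalgebra.comul (R := k) (n j : C) = ∑ i, c i ⊗ₜ[k] (n i : C) := by
    intro j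
    obtain ⟨t, ht⟩ := hΔ _ (n j).2
    obtain ⟨c, rfl⟩ := TensorProduct.eq_repr_basis_right n t
    refine ⟨c, ?_⟩
    rw [← ht, Finsupp.sum_fintype _ _ (by simp)]
    simp
  choose c hc using hrep
  have hdual : ∀ i, ∃ g : C →ₗ[k] k, ∀ l, g (n l) = if l = i then 1 else 0 := by
    intro i
    obtain ⟨g, hg⟩ := LinearMap.exists_extend (n.coord i)
    refine ⟨g, fun l => ?_⟩
    have := LinearMap.congr_fun hg (n l)
    simpa [Finsupp.single_apply] using this
  choose g hg using hdual
  have hcc : ∀ j i, Coalgebra.comul (R := k) (c j i) = ∑ l, c j l ⊗ₜ[k] c l i := by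
    intro j i
    have h := Coalgebra.coassoc_symm_apply (R := k) (n j : C)
    have h' := congrArg (TensorProduct.rid k (C ⊗[k] C)) (congrArg ((g i).lTensor (C ⊗[k] C)) h)
    simp only [hc, map_sum, LinearMap.lTensor_tmul, LinearMap.rTensor_tmul, TensorProduct.tmul_sum,
      TensorProduct.assoc_symm_tmul, hg, TensorProduct.rid_tmul, ite_smul, one_smul, zero_smul,
      Finset.sum_ite_eq', Finset.mem_univ, if_true] at h'
    exact h'.symm
  refine ⟨ofMatrix c hcc, ?_, ?_⟩
  · exact FiniteDimensional.span_of_finite k (Set.finite_range _)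
  · have hn : ∀ j, (n j : C) ∈ (ofMatrix c hcc).carrier := by
      intro j
      have h := congrArg (TensorProduct.rid k C) (Coalgebra.lTensor_counit_comul (R := k) (n j : C))
      rw [hc] at h
      simp only [map_sum, LinearMap.lTensor_tmul, TensorProduct.rid_tmul, one_smul] at h
      rw [← h]
      exact sum_mem fun i _ => Submodule.smul_mem _ _ (Submodule.subset_span ⟨(j, i), rfl⟩)
    have hx := congrArg Subtype.val (n.sum_repr ⟨x, hxN⟩)
    rw [AddSubmonoidClass.coe_finsetSum] at hx
    change _ = x at hx
    rw [← hx]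
    exact sum_mem fun i _ => Submodule.smul_mem _ _ (hn i)

/-- The image of a morphism of coalgebras is a subcoalgebra. -/
def range {D : Type w} [AddCommGroup D] [Module k D] [Coalgebra k D] (g : D →ₗc[k] C) :
    Subcoalgebra k C where
  carrier := LinearMap.range g.toLinearMap
  comul_mem := by
    rintro _ ⟨x, rfl⟩
    refine ⟨TensorProduct.map g.toLinearMap.rangeRestrict g.toLinearMap.rangeRestrict
      (Coalgebra.comul (R := k) x), ?_⟩
    rw [← LinearMap.comp_apply, ← TensorProduct.map_comp]
    exact LinearMap.congr_fun g.map_comp_comul x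

/-- Corestriction of a morphism of coalgebras to a subcoalgebra containing its image. -/
def codRestrict {D : Type w} [AddCommGroup D] [Module k D] [Coalgebra k D] (g : D →ₗc[k] C)
    (h : ∀ x, g x ∈ X.carrier) : D →ₗc[k] X.carrier where
  toLinearMap := g.toLinearMap.codRestrict X.carrier h
  counit_comp := g.counit_comp
  map_comp_comul := by
    refine LinearMap.cancel_left X.map_subtype_injective |>.1 ?_
    rw [← LinearMap.comp_assoc, ← TensorProduct.map_comp]
    exact g.map_comp_comul.trans
      (congrArg (· ∘ₗ g.toLinearMap.codRestrict X.carrier h) X.map_comulRestrict).symm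

end Subcoalgebra

section Cofree

variable (k) (V : Type v) [AddCommGroup V] [Module k V]

/-- A finite-dimensional coalgebra over `V`: a coalgebra structure on some `k ^ n`, together with a
linear map to `V`. -/
structure FinCoalgOver where
  n : ℕ
  coalg : Coalgebra k (Fin n → k)
  toV : (Fin n → k) →ₗ[k] V

variable {k V}

/-- The underlying vector space `k ^ n`, carrying the given coalgebra structure. -/
def FinCoalgOver.Carrier (A : FinCoalgOver k V) : Type u := Fin A.n → k

instance (A : FinCoalgOver k V) : AddCommGroup A.Carrier :=
  inferInstanceAs (AddCommGroup (Fin A.n → k))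

instance (A : FinCoalgOver k V) : Module k A.Carrier :=
  inferInstanceAs (Module k (Fin A.n → k))

instance (A : FinCoalgOver k V) : Coalgebra k A.Carrier := A.coalg

instance (A : FinCoalgOver k V) : FiniteDimensional k A.Carrier :=
  inferInstanceAs (FiniteDimensional k (Fin A.n → k))

/-- The structure map `A → V` of a coalgebra over `V`. -/
def FinCoalgOver.map (A : FinCoalgOver k V) : A.Carrier →ₗ[k] V := A.toV

instance : DecidableEq (FinCoalgOver k V) := Classical.decEq _

variable (k V)

/-- The direct sum of all finite-dimensional coalgebras over `V`. -/
abbrev CofreeSum : Type (max u v) := Π₀ A : FinCoalgOver k V, A.Carrier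

/-- The subspace of the direct sum spanned by all `φ(a) - a`, for `φ : A → B` a morphism of
finite-dimensional coalgebras over `V` and `a ∈ A`. -/
def cofreeRel : Submodule k (CofreeSum k V) :=
  Submodule.span k {x | ∃ (A B : FinCoalgOver k V) (φ : A.Carrier →ₗc[k] B.Carrier),
    B.map ∘ₗ φ.toLinearMap = A.map ∧
      ∃ a : A.Carrier, x = DFinsupp.single B (φ a) - DFinsupp.single A a}

instance : (cofreeRel k V).IsCoideal where
  counit_eq_zero := by
    intro x hx
    induction hx using Submodule.span_induction with
    | mem x hx =>
      obtain ⟨A, B, φ, -, a, rfl⟩ := hx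
      simp
    | zero => simp
    | add x y _ _ hx hy => simp [hx, hy]
    | smul c x _ hx => simp [hx]
  map_mkQ_comul_eq_zero := by
    intro x hx
    induction hx using Submodule.span_induction with
    | mem x hx =>
      obtain ⟨A, B, φ, hφ, a, rfl⟩ := hx
      have h : (cofreeRel k V).mkQ ∘ₗ DFinsupp.lsingle B ∘ₗ φ.toLinearMap =
          (cofreeRel k V).mkQ ∘ₗ DFinsupp.lsingle A := by
        ext b
        refine (Submodule.Quotient.eq _).2 ?_
        exact Submodule.subset_span ⟨A, B, φ, hφ, b, rfl⟩
      have hc : Coalgebra.comul (R := k) (φ a) =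
          TensorProduct.map φ.toLinearMap φ.toLinearMap (Coalgebra.comul (R := k) a) :=
        (LinearMap.congr_fun φ.map_comp_comul a).symm
      have ht : ∀ t, TensorProduct.map (cofreeRel k V).mkQ (cofreeRel k V).mkQ
          (TensorProduct.map (DFinsupp.lsingle B) (DFinsupp.lsingle B)
            (TensorProduct.map φ.toLinearMap φ.toLinearMap t)) =
          TensorProduct.map (cofreeRel k V).mkQ (cofreeRel k V).mkQ
            (TensorProduct.map (DFinsupp.lsingle A) (DFinsupp.lsingle A) t) := by
        intro t
        induction t with
        | zero => simp
        | add a b ha hb => simp only [map_add, ha, hb]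
        | tmul a b =>
          simp only [TensorProduct.map_tmul]
          exact congrArg₂ _ (LinearMap.congr_fun h a) (LinearMap.congr_fun h b)
      rw [map_sub, map_sub, DFinsupp.comul_single, DFinsupp.comul_single, hc, ht, sub_self]
    | zero => simp
    | add x y _ _ hx hy => simp [hx, hy]
    | smul c x _ hx => simp [hx]

/-- The cofree coalgebra `C(V)`, constructed as the colimit of all finite-dimensional coalgebras
over `V`. Its universal property is `CofreeCoalgebra.existsUnique_lift`. -/
abbrev CofreeCoalgebra : Type (max u v) := CofreeSum k V ⧸ cofreeRel k V

/-- The canonical map `p : C(V) → V`. -/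
def cofreeProj : CofreeCoalgebra k V →ₗ[k] V :=
  (cofreeRel k V).liftQ (DFinsupp.lsum k fun A => A.map) (by
    refine Submodule.span_le.2 ?_
    rintro x ⟨A, B, φ, hφ, a, rfl⟩
    have := LinearMap.congr_fun hφ a
    simp only [SetLike.mem_coe, LinearMap.mem_ker, map_sub, DFinsupp.lsum_single]
    exact sub_eq_zero.2 this)


variable {k V}

/-- Every finite-dimensional coalgebra over `V` is isomorphic to one on some `k ^ n`. -/
theorem exists_finCoalgOver {D : Type w} [AddCommGroup D] [Module k D] [Coalgebra k D]
    [FiniteDimensional k D] (f : D →ₗ[k] V) :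
    ∃ (A : FinCoalgOver k V) (e : D ≃ₗc[k] A.Carrier), A.map ∘ₗ e.toCoalgHom.toLinearMap = f := by
  let e : D ≃ₗ[k] (Fin (Module.finrank k D) → k) := (Module.finBasis k D).equivFun
  let _ : CoalgebraStruct k (Fin (Module.finrank k D) → k) :=
    { comul := TensorProduct.map e.toLinearMap e.toLinearMap ∘ₗ Coalgebra.comul (R := k) ∘ₗ
        e.symm.toLinearMap
      counit := Coalgebra.counit (R := k) ∘ₗ e.symm.toLinearMap }
  let E : D ≃ₗc[k] (Fin (Module.finrank k D) → k) :=
    { e with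
      counit_comp := by
        ext x
        exact congrArg (Coalgebra.counit (R := k)) (e.symm_apply_apply x)
      map_comp_comul := by
        ext x
        exact congrArg (fun y => TensorProduct.map e.toLinearMap e.toLinearMap
          (Coalgebra.comul (R := k) y)) (e.symm_apply_apply x).symm }
  refine ⟨⟨_, E.toCoalgebra, f ∘ₗ e.symm.toLinearMap⟩, E, ?_⟩
  ext x
  exact congrArg f (e.symm_apply_apply x)

/-- The canonical morphism `A → C(V)`. -/
def FinCoalgOver.toCofree (A : FinCoalgOver k V) : A.Carrier →ₗc[k] CofreeCoalgebra k V :=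
  (Coalgebra.Quotient.mkQCoalgHom (cofreeRel k V)).comp
    { toLinearMap := DFinsupp.lsingle A
      counit_comp := DFinsupp.counit_comp_lsingle _ _ _ A
      map_comp_comul := (DFinsupp.comul_comp_lsingle _ _ _ A).symm }

theorem FinCoalgOver.proj_toCofree (A : FinCoalgOver k V) (a : A.Carrier) :
    cofreeProj k V (A.toCofree a) = A.map a :=
  DFinsupp.lsum_single k (fun A : FinCoalgOver k V => A.map) A a

theorem FinCoalgOver.toCofree_comp {A B : FinCoalgOver k V} (φ : A.Carrier →ₗc[k] B.Carrier)
    (hφ : B.map ∘ₗ φ.toLinearMap = A.map) (a : A.Carrier) :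
    B.toCofree (φ a) = A.toCofree a :=
  (Submodule.Quotient.eq _).2 (Submodule.subset_span ⟨A, B, φ, hφ, a, rfl⟩)

theorem exists_lift_finite {D : Type w} [AddCommGroup D] [Module k D] [Coalgebra k D]
    [FiniteDimensional k D] (f : D →ₗ[k] V) :
    ∃ g : D →ₗc[k] CofreeCoalgebra k V, ∃ (A : FinCoalgOver k V) (e : D ≃ₗc[k] A.Carrier),
      A.map ∘ₗ e.toCoalgHom.toLinearMap = f ∧ g = A.toCofree.comp e.toCoalgHom := by
  obtain ⟨A, e, h⟩ := exists_finCoalgOver f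
  exact ⟨_, A, e, h, rfl⟩

/-- The canonical lift of a linear map on a finite-dimensional coalgebra. -/
def liftFin {D : Type w} [AddCommGroup D] [Module k D] [Coalgebra k D]
    [FiniteDimensional k D] (f : D →ₗ[k] V) : D →ₗc[k] CofreeCoalgebra k V :=
  (exists_lift_finite f).choose

theorem liftFin_spec {D : Type w} [AddCommGroup D] [Module k D] [Coalgebra k D]
    [FiniteDimensional k D] (f : D →ₗ[k] V) :
    ∃ (A : FinCoalgOver k V) (e : D ≃ₗc[k] A.Carrier),
      A.map ∘ₗ e.toCoalgHom.toLinearMap = f ∧ liftFin f = A.toCofree.comp e.toCoalgHom :=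
  (exists_lift_finite f).choose_spec

theorem proj_liftFin {D : Type w} [AddCommGroup D] [Module k D] [Coalgebra k D]
    [FiniteDimensional k D] (f : D →ₗ[k] V) (x : D) :
    cofreeProj k V (liftFin f x) = f x := by
  obtain ⟨A, e, h, hg⟩ := liftFin_spec f
  rw [hg]
  exact (A.proj_toCofree _).trans (LinearMap.congr_fun h x)

theorem liftFin_comp {D : Type w} [AddCommGroup D] [Module k D] [Coalgebra k D]
    [FiniteDimensional k D] {D' : Type w'} [AddCommGroup D'] [Module k D'] [Coalgebra k D']
    [FiniteDimensional k D'] (f : D →ₗ[k] V) (f' : D' →ₗ[k] V) (φ : D →ₗc[k] D')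
    (h : ∀ x, f' (φ x) = f x) (x : D) : liftFin f' (φ x) = liftFin f x := by
  obtain ⟨A, e, hA, hg⟩ := liftFin_spec f
  obtain ⟨A', e', hA', hg'⟩ := liftFin_spec f'
  rw [hg, hg']
  have := FinCoalgOver.toCofree_comp (A := A) (B := A')
    ((e'.toCoalgHom.comp φ).comp e.symm.toCoalgHom) (by
      ext a
      refine (LinearMap.congr_fun hA' (φ (e.symm a))).trans ((h _).trans ?_)
      refine (LinearMap.congr_fun hA (e.symm a)).symm.trans ?_
      exact congrArg A.map (e.apply_symm_apply a)) (e x)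
  refine Eq.trans ?_ this
  exact congrArg (fun y => A'.toCofree (e' (φ y))) (e.symm_apply_apply x).symm

section

variable {D : Type w} [AddCommGroup D] [Module k D] [Coalgebra k D]

instance sum_finite (E E' : Subcoalgebra k D) [FiniteDimensional k E.carrier]
    [FiniteDimensional k E'.carrier] :
    FiniteDimensional k (Subcoalgebra.sum {E, E'}).carrier := by
  have : (Subcoalgebra.sum {E, E'}).carrier = E.carrier ⊔ E'.carrier := by
    simp [Subcoalgebra.sum, iSup_or, iSup_sup_eq]
  rw [this]
  infer_instance

theorem liftFin_le (f : D →ₗ[k] V) (E E' : Subcoalgebra k D) [FiniteDimensional k E.carrier]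
    [FiniteDimensional k E'.carrier] (h : E.carrier ≤ E'.carrier) (x : D) (hx : x ∈ E.carrier) :
    liftFin (f ∘ₗ E'.carrier.subtype) ⟨x, h hx⟩ = liftFin (f ∘ₗ E.carrier.subtype) ⟨x, hx⟩ :=
  liftFin_comp (f ∘ₗ E.carrier.subtype) (f ∘ₗ E'.carrier.subtype)
    (E'.codRestrict E.incl fun y => h y.2) (fun _ => rfl) ⟨x, hx⟩

theorem liftFin_eq (f : D →ₗ[k] V) (E E' : Subcoalgebra k D) [FiniteDimensional k E.carrier]
    [FiniteDimensional k E'.carrier] (x : D) (hx : x ∈ E.carrier) (hx' : x ∈ E'.carrier) :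
    liftFin (f ∘ₗ E'.carrier.subtype) ⟨x, hx'⟩ = liftFin (f ∘ₗ E.carrier.subtype) ⟨x, hx⟩ := by
  have h1 : E.carrier ≤ (Subcoalgebra.sum {E, E'}).carrier := le_iSup₂_of_le E (by simp) le_rfl
  have h2 : E'.carrier ≤ (Subcoalgebra.sum {E, E'}).carrier := le_iSup₂_of_le E' (by simp) le_rfl
  rw [← liftFin_le f E _ h1 x hx, ← liftFin_le f E' _ h2 x hx']

/-- The lift of a linear map `f : D → V` to `D → C(V)`, as a function. -/
def liftFun (f : D →ₗ[k] V) (x : D) : CofreeCoalgebra k V :=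
  haveI := (Subcoalgebra.exists_finite (k := k) x).choose_spec.1
  liftFin (f ∘ₗ (Subcoalgebra.exists_finite (k := k) x).choose.carrier.subtype)
    ⟨x, (Subcoalgebra.exists_finite (k := k) x).choose_spec.2⟩

theorem liftFun_eq (f : D →ₗ[k] V) (E : Subcoalgebra k D) [FiniteDimensional k E.carrier]
    (x : D) (hx : x ∈ E.carrier) :
    liftFun f x = liftFin (f ∘ₗ E.carrier.subtype) ⟨x, hx⟩ :=
  haveI := (Subcoalgebra.exists_finite (k := k) x).choose_spec.1
  liftFin_eq f E _ x hx _

/-- The lift of a linear map `f : D → V` on a coalgebra `D` to a linear map `D → C(V)`. -/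
def liftLin (f : D →ₗ[k] V) : D →ₗ[k] CofreeCoalgebra k V where
  toFun := liftFun f
  map_add' x y := by
    obtain ⟨E, hE, hx⟩ := Subcoalgebra.exists_finite (k := k) x
    obtain ⟨E', hE', hy⟩ := Subcoalgebra.exists_finite (k := k) y
    have h1 : E.carrier ≤ (Subcoalgebra.sum {E, E'}).carrier := le_iSup₂_of_le E (by simp) le_rfl
    have h2 : E'.carrier ≤ (Subcoalgebra.sum {E, E'}).carrier := le_iSup₂_of_le E' (by simp) le_rfl
    rw [liftFun_eq f _ x (h1 hx), liftFun_eq f _ y (h2 hy),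
      liftFun_eq f _ (x + y) (add_mem (h1 hx) (h2 hy)), ← map_add]
    rfl
  map_smul' a x := by
    obtain ⟨E, hE, hx⟩ := Subcoalgebra.exists_finite (k := k) x
    rw [liftFun_eq f E x hx, liftFun_eq f E (a • x) (Submodule.smul_mem _ a hx), RingHom.id_apply,
      ← map_smul]
    rfl

theorem liftLin_comp_incl (f : D →ₗ[k] V) (E : Subcoalgebra k D) [FiniteDimensional k E.carrier] :
    liftLin f ∘ₗ E.carrier.subtype = (liftFin (f ∘ₗ E.carrier.subtype)).toLinearMap := by
  ext x
  exact liftFun_eq f E x.1 x.2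

/-- The lift of a linear map `f : D → V` on a coalgebra `D` to a morphism `D → C(V)`. -/
def CofreeCoalgebra.lift (f : D →ₗ[k] V) : D →ₗc[k] CofreeCoalgebra k V where
  toLinearMap := liftLin f
  counit_comp := by
    ext x
    obtain ⟨E, hE, hx⟩ := Subcoalgebra.exists_finite (k := k) x
    exact (congrArg _ (LinearMap.congr_fun (liftLin_comp_incl f E) ⟨x, hx⟩)).trans
      (LinearMap.congr_fun (liftFin (f ∘ₗ E.carrier.subtype)).counit_comp ⟨x, hx⟩)
  map_comp_comul := by
    ext x
    obtain ⟨E, hE, hx⟩ := Subcoalgebra.exists_finite (k := k) x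
    have h := LinearMap.congr_fun (liftFin (f ∘ₗ E.carrier.subtype)).map_comp_comul ⟨x, hx⟩
    rw [← liftLin_comp_incl, TensorProduct.map_comp, LinearMap.comp_assoc] at h
    refine Eq.trans ?_ h
    exact congrArg _ (E.map_comulRestrict_apply ⟨x, hx⟩).symm

theorem CofreeCoalgebra.proj_lift (f : D →ₗ[k] V) :
    cofreeProj k V ∘ₗ (CofreeCoalgebra.lift f).toLinearMap = f := by
  ext x
  obtain ⟨E, hE, hx⟩ := Subcoalgebra.exists_finite (k := k) x
  exact (congrArg _ (LinearMap.congr_fun (liftLin_comp_incl f E) ⟨x, hx⟩)).trans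
    (proj_liftFin _ _)

theorem lift_proj (y : CofreeCoalgebra k V) : CofreeCoalgebra.lift (cofreeProj k V) y = y := by
  have h : (CofreeCoalgebra.lift (cofreeProj k V)).toLinearMap ∘ₗ (cofreeRel k V).mkQ =
      (cofreeRel k V).mkQ := by
    refine DFinsupp.lhom_ext fun A a => ?_
    change liftFun (cofreeProj k V) (A.toCofree a) = A.toCofree a
    have : FiniteDimensional k (Subcoalgebra.range A.toCofree).carrier :=
      inferInstanceAs (FiniteDimensional k (LinearMap.range A.toCofree.toLinearMap))
    refine (liftFun_eq _ (Subcoalgebra.range A.toCofree) _ ⟨a, rfl⟩).trans ?_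
    refine (liftFin_comp A.map _ (Subcoalgebra.codRestrict (Subcoalgebra.range A.toCofree) A.toCofree fun x => ⟨x, rfl⟩)
      (fun x => A.proj_toCofree x) a).trans ?_
    obtain ⟨B, e, hB, hg⟩ := liftFin_spec A.map
    rw [hg]
    exact FinCoalgOver.toCofree_comp e.toCoalgHom hB a
  obtain ⟨z, rfl⟩ := (cofreeRel k V).mkQ_surjective y
  exact LinearMap.congr_fun h z

/-- The universal property of the cofree coalgebra. -/
theorem CofreeCoalgebra.existsUnique_lift (f : D →ₗ[k] V) :
    ∃! g : D →ₗc[k] CofreeCoalgebra k V, cofreeProj k V ∘ₗ g.toLinearMap = f := by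
  refine ⟨CofreeCoalgebra.lift f, CofreeCoalgebra.proj_lift f, fun g hg => ?_⟩
  refine CoalgHom.ext fun x => ?_
  obtain ⟨E, hE, hx⟩ := Subcoalgebra.exists_finite (k := k) x
  have hfin : FiniteDimensional k (Subcoalgebra.range (g.comp E.incl)).carrier :=
    inferInstanceAs (FiniteDimensional k (LinearMap.range (g.comp E.incl).toLinearMap))
  have h1 : CofreeCoalgebra.lift f x = liftFin (f ∘ₗ E.carrier.subtype) ⟨x, hx⟩ :=
    liftFun_eq f E x hx
  have h2 := liftFin_comp (f ∘ₗ E.carrier.subtype)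
    (cofreeProj k V ∘ₗ (Subcoalgebra.range (g.comp E.incl)).carrier.subtype)
    (Subcoalgebra.codRestrict (Subcoalgebra.range (g.comp E.incl)) (g.comp E.incl) fun x => ⟨x, rfl⟩)
    (fun y => LinearMap.congr_fun hg y.1) ⟨x, hx⟩
  rw [h1, ← h2, ← lift_proj (g x)]
  exact liftFun_eq (cofreeProj k V) (Subcoalgebra.range (g.comp E.incl)) (g x) ⟨⟨x, hx⟩, rfl⟩

end

end Cofree

end Coalgebras

section Corepresentations

variable (k : Type u) [Field k]

/-- The map `x ⊗ c ↦ x ⊗ c₍₁₎ ⊗ c₍₂₎`. -/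
def rightComul (X : Type w) [AddCommGroup X] [Module k X] (C : Type v) [AddCommGroup C] [Module k C]
    [Coalgebra k C] : X ⊗[k] C →ₗ[k] (X ⊗[k] C) ⊗[k] C :=
  (TensorProduct.assoc k X C C).symm.toLinearMap ∘ₗ (Coalgebra.comul (R := k)).lTensor X

variable (H : Type v) [Ring H] [HopfAlgebra k H]

/-- The map `h ⊗ g ↦ h S(g)`. -/
def mulAntipode : H ⊗[k] H →ₗ[k] H :=
  LinearMap.mul' k H ∘ₗ (HopfAlgebra.antipode k (A := H)).lTensor H

/-- The map `x ⊗ h ⊗ g ↦ x ⊗ h S(g)`. -/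
def rightMulAntipode (X : Type w) [AddCommGroup X] [Module k X] :
    (X ⊗[k] H) ⊗[k] H →ₗ[k] X ⊗[k] H :=
  (mulAntipode k H).lTensor X ∘ₗ (TensorProduct.assoc k X H H).toLinearMap

variable {H}

/-- A linear map `ω : C → H` from a coalgebra to a Hopf algebra is a partial corepresentation. -/
structure IsPartialCorep {C : Type w} [AddCommGroup C] [Module k C] [Coalgebra k C]
    (ω : C →ₗ[k] H) : Prop where
  /-- `ε(ω(c)) = ε(c)` -/
  counit_comp : Coalgebra.counit (R := k) ∘ₗ ω = Coalgebra.counit (R := k)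
  /-- `ω(c₍₁₎)₍₁₎ ⊗ ω(c₍₁₎)₍₂₎ S(ω(c₍₂₎)) = ω(c₍₁₎) ⊗ ω(c₍₂₎) S(ω(c₍₃₎))` -/
  comul_left : rightMulAntipode k H H ∘ₗ (Coalgebra.comul (R := k)).rTensor H ∘ₗ
      TensorProduct.map ω ω ∘ₗ Coalgebra.comul (R := k) =
    rightMulAntipode k H H ∘ₗ TensorProduct.map (TensorProduct.map ω ω) ω ∘ₗ
      (Coalgebra.comul (R := k)).rTensor C ∘ₗ Coalgebra.comul (R := k)
  /-- `ω(c₍₁₎) S(ω(c₍₂₎)₍₁₎) ⊗ ω(c₍₂₎)₍₂₎ = ω(c₍₁₎) S(ω(c₍₂₎)) ⊗ ω(c₍₃₎)` -/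
  comul_right : (mulAntipode k H).rTensor H ∘ₗ rightComul k H H ∘ₗ
      TensorProduct.map ω ω ∘ₗ Coalgebra.comul (R := k) =
    (mulAntipode k H).rTensor H ∘ₗ TensorProduct.map (TensorProduct.map ω ω) ω ∘ₗ
      (Coalgebra.comul (R := k)).rTensor C ∘ₗ Coalgebra.comul (R := k)

variable (H)

/-- The universal corep-coalgebra `H^par`: the sum of all subcoalgebras `X` of the cofree coalgebra
`C(H)` for which the restriction of `p : C(H) → H` to `X` is a partial corepresentation. -/
def Hpar : Subcoalgebra k (CofreeCoalgebra k H) :=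
  Subcoalgebra.sum {X | IsPartialCorep k (cofreeProj k H ∘ₗ X.carrier.subtype)}

/-- The restriction `p : H^par → H` of the canonical map `p : C(H) → H`. -/
def hparProj : (Hpar k H).carrier →ₗ[k] H := cofreeProj k H ∘ₗ (Hpar k H).carrier.subtype

end Corepresentations

section Comodules

variable (k : Type u) [Field k]

/-- `ρ : M → M ⊗ C` makes `M` a (right) comodule over the coalgebra `C`. -/
structure IsComodule {C : Type v} [AddCommGroup C] [Module k C] [Coalgebra k C]
    {M : Type w} [AddCommGroup M] [Module k M] (ρ : M →ₗ[k] M ⊗[k] C) : Prop where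
  /-- `m⁰ ε(m¹) = m` -/
  counit : (TensorProduct.rid k M).toLinearMap ∘ₗ (Coalgebra.counit (R := k)).lTensor M ∘ₗ ρ =
    LinearMap.id
  /-- `m⁰⁰ ⊗ m⁰¹ ⊗ m¹ = m⁰ ⊗ m¹₍₁₎ ⊗ m¹₍₂₎` -/
  coassoc : ρ.rTensor C ∘ₗ ρ = rightComul k M C ∘ₗ ρ

/-- `ρ : M → M ⊗ H` makes `M` an (algebraic) partial right comodule over the Hopf algebra `H`. -/
structure IsPartialComodule {H : Type v} [Ring H] [HopfAlgebra k H]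
    {M : Type w} [AddCommGroup M] [Module k M] (ρ : M →ₗ[k] M ⊗[k] H) : Prop where
  /-- `m⁰ ε(m¹) = m` -/
  counit : (TensorProduct.rid k M).toLinearMap ∘ₗ (Coalgebra.counit (R := k)).lTensor M ∘ₗ ρ =
    LinearMap.id
  /-- `m⁰⁰ ⊗ m⁰¹₍₁₎ ⊗ m⁰¹₍₂₎ S(m¹) = m⁰⁰⁰ ⊗ m⁰⁰¹ ⊗ m⁰¹ S(m¹)` -/
  comul_left : rightMulAntipode k H (M ⊗[k] H) ∘ₗ (rightComul k M H).rTensor H ∘ₗ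
      ρ.rTensor H ∘ₗ ρ =
    rightMulAntipode k H (M ⊗[k] H) ∘ₗ (ρ.rTensor H).rTensor H ∘ₗ ρ.rTensor H ∘ₗ ρ
  /-- `m⁰⁰ ⊗ m⁰¹ S(m¹₍₁₎) ⊗ m¹₍₂₎ = m⁰⁰⁰ ⊗ m⁰⁰¹ S(m⁰¹) ⊗ m¹` -/
  comul_right : (rightMulAntipode k H M).rTensor H ∘ₗ rightComul k (M ⊗[k] H) H ∘ₗ
      ρ.rTensor H ∘ₗ ρ =
    (rightMulAntipode k H M).rTensor H ∘ₗ (ρ.rTensor H).rTensor H ∘ₗ ρ.rTensor H ∘ₗ ρ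

/-- A pair `(M, ρ)` of a vector space `M` and a linear map `ρ : M → M ⊗ D`, with no axioms. -/
structure Coaction (D : Type v) [AddCommGroup D] [Module k D] where
  carrier : Type w
  [addCommGroup : AddCommGroup carrier]
  [module : Module k carrier]
  coact : carrier →ₗ[k] carrier ⊗[k] D

namespace Coaction

attribute [instance] addCommGroup module

variable {k} {D : Type v} [AddCommGroup D] [Module k D]

/-- A morphism `(M, ρ) → (N, σ)` is a linear map `f` with `σ ∘ f = (f ⊗ I) ∘ ρ`. -/
@[ext]
structure Hom (M N : Coaction.{u, v, w} k D) where
  toLin : M.carrier →ₗ[k] N.carrier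
  colinear : N.coact ∘ₗ toLin = toLin.rTensor D ∘ₗ M.coact

instance : Category (Coaction.{u, v, w} k D) where
  Hom := Hom
  id M := ⟨LinearMap.id, by rw [LinearMap.rTensor_id]; rfl⟩
  comp f g := ⟨g.toLin ∘ₗ f.toLin, by
    rw [← LinearMap.comp_assoc, g.colinear, LinearMap.comp_assoc, f.colinear,
      ← LinearMap.comp_assoc, ← LinearMap.rTensor_comp]⟩

variable (k D)

/-- The forgetful functor `(M, ρ) ↦ M`. -/
def forget : Coaction.{u, v, w} k D ⥤ ModuleCat.{w} k where
  obj M := ModuleCat.of k M.carrier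
  map f := ModuleCat.ofHom f.toLin

variable {k D}

/-- The functor `(M, ρ) ↦ (M, (I ⊗ p) ∘ ρ)`, identical on morphisms, for a linear map
`p : D → D'`. -/
def push {D' : Type w'} [AddCommGroup D'] [Module k D'] (p : D →ₗ[k] D') :
    Coaction.{u, v, w} k D ⥤ Coaction.{u, w', w} k D' where
  obj M := ⟨M.carrier, p.lTensor M.carrier ∘ₗ M.coact⟩
  map {M N} f := ⟨f.toLin, by
    change (p.lTensor N.carrier ∘ₗ N.coact) ∘ₗ f.toLin =
      f.toLin.rTensor D' ∘ₗ p.lTensor M.carrier ∘ₗ M.coact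
    rw [LinearMap.comp_assoc, f.colinear, ← LinearMap.comp_assoc, ← LinearMap.comp_assoc,
      LinearMap.lTensor_comp_rTensor, LinearMap.rTensor_comp_lTensor]⟩

end Coaction

/-- The category `Mod^C` of right comodules over a coalgebra `C`. -/
abbrev ComoduleCat (C : Type v) [AddCommGroup C] [Module k C] [Coalgebra k C] :=
  ObjectProperty.FullSubcategory fun M : Coaction.{u, v, w} k C => IsComodule k M.coact

/-- The category `Mod^H_par` of partial right comodules over a Hopf algebra `H`. -/
abbrev PartialComoduleCat (H : Type v) [Ring H] [HopfAlgebra k H] :=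
  ObjectProperty.FullSubcategory fun M : Coaction.{u, v, w} k H => IsPartialComodule k M.coact

end Comodules

section Firm

/-- The subgroup of `R ⊗ M` (tensor product of abelian groups) generated by all
`rs ⊗ m - r ⊗ sm`. -/
def balancedRel {R : Type v} [NonUnitalRing R] {M : Type w} [AddCommGroup M]
    (act : R →ₙ+* AddMonoid.End M) : AddSubgroup (R ⊗[ℤ] M) :=
  AddSubgroup.closure {x | ∃ (r s : R) (m : M), x = (r * s) ⊗ₜ[ℤ] m - r ⊗ₜ[ℤ] act s m}

/-- The action map `R ⊗ M → M` on the tensor product of abelian groups. -/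
def actionMap {R : Type v} [NonUnitalRing R] {M : Type w} [AddCommGroup M]
    (act : R →ₙ+* AddMonoid.End M) : R ⊗[ℤ] M →+ M :=
  TensorProduct.liftAddHom (R := ℤ) (M := R) (N := M) (P := M) (act : R →+ AddMonoid.End M)
    (fun n r m => by
      change act (n • r) m = act r (n • m)
      rw [map_zsmul, map_zsmul]
      rfl)

/-- A left module over a (possibly non-unital) ring `R`, given by its action on the abelian group
`M`, is firm if the action induces an isomorphism `R ⊗_R M ≅ M`. -/
def IsFirmModule {R : Type v} [NonUnitalRing R] {M : Type w} [AddCommGroup M]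
    (act : R →ₙ+* AddMonoid.End M) : Prop :=
  Function.Bijective (QuotientAddGroup.lift (balancedRel act) (actionMap act) (by
    refine (AddSubgroup.closure_le _).2 ?_
    rintro x ⟨r, s, m, rfl⟩
    change actionMap act ((r * s) ⊗ₜ[ℤ] m - r ⊗ₜ[ℤ] act s m) = 0
    rw [map_sub]
    change act (r * s) m - act r (act s m) = 0
    rw [map_mul]
    exact sub_self _))

/-- The action of a ring on itself by left multiplication. -/
def leftMulAction (R : Type v) [NonUnitalRing R] : R →ₙ+* AddMonoid.End R where
  toFun := AddMonoidHom.mulLeft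
  map_mul' r s := by ext x; exact mul_assoc r s x
  map_zero' := by ext x; exact zero_mul x
  map_add' r s := by ext x; exact add_mul r s x

/-- A (possibly non-unital) ring `R` is firm if multiplication induces an isomorphism
`R ⊗_R R ≅ R`. -/
def IsFirmRing (R : Type v) [NonUnitalRing R] : Prop := IsFirmModule (leftMulAction R)

variable {k : Type u} [Field k]

/-- The map `M ⊗ M^* → End(M)` sending `e ⊗ f` to `m ↦ f(m) e`. -/
def finiteRankEnd (M : Type w) [AddCommGroup M] [Module k M] :
    M ⊗[k] Module.Dual k M →ₗ[k] Module.End k M :=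
  dualTensorHom k M M ∘ₗ (TensorProduct.comm k M (Module.Dual k M)).toLinearMap

/-- The multiplication of the (non-unital) ring `M ⊗ M^*`: `(e ⊗ f)(e' ⊗ f') = f(e') e ⊗ f'`. -/
def finiteRankMul {M : Type w} [AddCommGroup M] [Module k M] (s t : M ⊗[k] Module.Dual k M) :
    M ⊗[k] Module.Dual k M :=
  (finiteRankEnd M s).rTensor (Module.Dual k M) t

theorem finiteRankEnd_mul {M : Type w} [AddCommGroup M] [Module k M]
    (s t : M ⊗[k] Module.Dual k M) :
    finiteRankEnd M (finiteRankMul s t) = finiteRankEnd M s * finiteRankEnd M t := by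
  induction t with
  | zero => simp [finiteRankMul]
  | add a b ha hb =>
    have h : finiteRankMul s (a + b) = finiteRankMul s a + finiteRankMul s b :=
      map_add _ _ _
    rw [h, map_add, map_add, ha, hb, mul_add]
  | tmul e f =>
    ext m
    simp [finiteRankMul, finiteRankEnd]

/-- The action of `R` on `M` induced by a ring morphism `φ : R → M ⊗ M^*`: if `φ(r) = ∑ e ⊗ f` then
`r m = ∑ f(m) e`. -/
def inducedAction {R : Type v} [NonUnitalRing R] {M : Type w} [AddCommGroup M] [Module k M]
    (φ : R →+ M ⊗[k] Module.Dual k M) (hφ : ∀ r s, φ (r * s) = finiteRankMul (φ r) (φ s)) :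
    R →ₙ+* AddMonoid.End M where
  toFun r := (finiteRankEnd M (φ r)).toAddMonoidHom
  map_mul' r s := by
    ext m
    rw [hφ]
    exact LinearMap.congr_fun (finiteRankEnd_mul (φ r) (φ s)) m
  map_zero' := by rw [map_zero, map_zero]; rfl
  map_add' r s := by rw [map_add, map_add]; rfl

/-- `M` is `R`-firmly projective through the ring morphism `φ : R → M ⊗ M^*`: the induced action
makes `M` a firm left `R`-module. -/
def IsFirmlyProjectiveVia {R : Type v} [NonUnitalRing R] {M : Type w} [AddCommGroup M] [Module k M]
    (φ : R →+ M ⊗[k] Module.Dual k M) : Prop :=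
  ∃ hφ : ∀ r s, φ (r * s) = finiteRankMul (φ r) (φ s), IsFirmModule (inducedAction φ hφ)

/-- `(M, ρ)` is firmly projective: `M` is `R`-firmly projective as a vector space for a firm ring
`R` of endomorphisms of `(M, ρ)`, the action of `R` on `M` being by evaluation. -/
def Coaction.IsFirmlyProjective {D : Type v} [AddCommGroup D] [Module k D]
    (M : Coaction.{u, v, w} k D) : Prop :=
  ∃ R : NonUnitalSubring (Module.End k M.carrier),
    (∀ r ∈ R, M.coact ∘ₗ r = r.rTensor D ∘ₗ M.coact) ∧ IsFirmRing R ∧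
    ∃ φ : R →+ M.carrier ⊗[k] Module.Dual k M.carrier, IsFirmlyProjectiveVia φ ∧
      ∀ r : R, finiteRankEnd M.carrier (φ r) = (r : Module.End k M.carrier)

end Firm

section Categories

/-- A functor is an isomorphism of categories if it has a strict two-sided inverse. -/
def IsIsoOfCategories {𝒜 : Type*} [Category 𝒜] {ℬ : Type*} [Category ℬ] (F : 𝒜 ⥤ ℬ) : Prop :=
  ∃ G : ℬ ⥤ 𝒜, F ⋙ G = 𝟭 𝒜 ∧ G ⋙ F = 𝟭 ℬ

/-- The restriction of a functor `F` to full subcategories, the objects of the first being mapped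
to objects of the second. -/
def restrictFunctor {𝒜 : Type*} [Category 𝒜] {ℬ : Type*} [Category ℬ] (F : 𝒜 ⥤ ℬ)
    (P : ObjectProperty 𝒜) (Q : ObjectProperty ℬ) (h : ∀ X, P X → Q (F.obj X)) :
    P.FullSubcategory ⥤ Q.FullSubcategory :=
  Q.lift (P.ι ⋙ F) fun X => h X.obj X.property

variable {k : Type u} [Field k]

/-- The coalgebra `C`, with the natural coactions `δ_X : U(X) → U(X) ⊗ C`, is the coalgebra
reconstructed from the functor `U : 𝒜 → Vect` by the Tannakian formalism, i.e. the coend of `U`: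
every natural transformation `U → U ⊗ V` is `(I ⊗ g) ∘ δ` for exactly one linear map `g : C → V`,
and the comultiplication and counit of `C` are the ones (unique by this universal property)
for which each `δ_X` is a `C`-comodule structure. -/
structure IsTannakaReconstruction {𝒜 : Type*} [Category 𝒜] (U : 𝒜 ⥤ ModuleCat.{w} k)
    (C : Type v) [AddCommGroup C] [Module k C] [Coalgebra k C]
    (δ : ∀ X, U.obj X →ₗ[k] U.obj X ⊗[k] C) : Prop where
  isComodule : ∀ X, IsComodule k (δ X)
  natural : ∀ {X Y : 𝒜} (f : X ⟶ Y),
    δ Y ∘ₗ (U.map f).hom = (U.map f).hom.rTensor C ∘ₗ δ X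
  universal : ∀ (V : Type w') [AddCommGroup V] [Module k V]
    (τ : ∀ X, U.obj X →ₗ[k] U.obj X ⊗[k] V),
    (∀ {X Y : 𝒜} (f : X ⟶ Y), τ Y ∘ₗ (U.map f).hom = (U.map f).hom.rTensor V ∘ₗ τ X) →
    ∃! g : C →ₗ[k] V, ∀ X, g.lTensor (U.obj X) ∘ₗ δ X = τ X

variable (k) (H : Type v) [Ring H] [HopfAlgebra k H]

/-- The functor `(M, ρ̂) ↦ (M, (I ⊗ p) ∘ ρ̂)` from `H^par`-comodules to partial `H`-comodules, given
that these pairs are partial `H`-comodules. -/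
def Gamma (h : ∀ M : Coaction.{u, max u v, w} k (Hpar k H).carrier, IsComodule k M.coact →
      IsPartialComodule k ((Coaction.push (hparProj k H)).obj M).coact) :
    ComoduleCat.{u, max u v, w} k (Hpar k H).carrier ⥤ PartialComoduleCat.{u, v, w} k H :=
  restrictFunctor (Coaction.push (hparProj k H)) _ _ h

/-- The category of finite-dimensional partial `H`-comodules. -/
abbrev FinPartialComoduleCat :=
  ObjectProperty.FullSubcategory fun N : PartialComoduleCat.{u, v, w} k H =>
    FiniteDimensional k N.obj.carrier

/-- The fibre functor from finite-dimensional partial `H`-comodules to vector spaces. -/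
abbrev fibreFunctor : FinPartialComoduleCat.{u, v, w} k H ⥤ ModuleCat.{w} k :=
  ObjectProperty.ι _ ⋙ ObjectProperty.ι _ ⋙ Coaction.forget k H

end Categories

end

end PartialComodule

open PartialComodule

/-!
The proof rests on two properties of `p : H^par → H`. It is a partial corepresentation, and every
partial corepresentation `C → H` factors through it by a morphism of coalgebras
(`isPartialCorep_hparProj`, `IsPartialCorep.exists_lift`); and its kernel contains no nonzero
coideal, because lifts to the cofree coalgebra are unique
(`eq_bot_of_isCoideal_of_le_ker_hparProj`).

For a comodule `(M, ρ)` over a coalgebra `D` and a linear map `ω : D → H`, each axiom of a partial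
comodule for `(I ⊗ ω) ρ` is the corresponding axiom of a partial corepresentation for `ω`, applied
to the second leg of `ρ` (`isPartialComodule_push_iff`). With `ω = p` this defines `Γ`. If the
coefficients `f(m⁰) m¹` span `D`, it can be read backwards, and `ω` is a partial corepresentation
as soon as `(I ⊗ ω) ρ` is a partial comodule.

`Γ` is full: if `f : M → N` is a morphism of partial comodules between `H^par`-comodules, the
differences `ψ(f(m)⁰) f(m)¹ - ψ(f(m⁰)) m¹` span a coideal in the kernel of `p`, so they vanish
(`IsComodule.colinear_of_push`). For `f = id` this also shows that `Γ` is injective on objects.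

A firmly projective partial comodule `M` has a ring `R` of endomorphisms of finite rank with
`R M = M`. Then `Q = M^* ⊗_R M` is a coalgebra coacting on `M` by `r n ↦ ∑ eᵢ ⊗ [fᵢ ⊗ n]` for
`r = ∑ eᵢ ⊗ fᵢ`. A linear map `M → M ⊗ V` that commutes with `R` factors through this coaction by
exactly one linear map `Q → V`. The partial coaction of `M` therefore gives a map `Q → H`, a partial
corepresentation since the coefficients of `M` span `Q`; its lift `Q → H^par` makes `M` an
`H^par`-comodule over the given partial comodule (`IsPartialComodule.exists_lift`). By fullness,
`R` acts by comodule endomorphisms. Finite-dimensional partial comodules are firmly projective for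
the ring of all their endomorphisms.

Consequently natural transformations of the fibre functor can be computed on finite-dimensional
`H^par`-comodules, and the coend is a general fact about coalgebras
(`existsUnique_of_natural`): `g : H^par → V` is given on a finite-dimensional subcoalgebra `X` by
`(ε ⊗ I) τ_X`.
-/

namespace PartialComodule

noncomputable section

/-! ### Isomorphisms of categories -/

/-- A fully faithful functor that is bijective on objects has a strict inverse. -/
theorem isIsoOfCategories_of_bijective {𝒜 : Type*} [Category 𝒜] {ℬ : Type*} [Category ℬ]
    (F : 𝒜 ⥤ ℬ) [F.Full] [F.Faithful] (hF : Function.Bijective F.obj) :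
    IsIsoOfCategories F := by
  let e := Equiv.ofBijective F.obj hF
  have he : ∀ Y, F.obj (e.symm Y) = Y := e.apply_symm_apply
  have he' : ∀ X, e.symm (F.obj X) = X := e.symm_apply_apply
  let G : ℬ ⥤ 𝒜 :=
    { obj := e.symm
      map := fun {X Y} f => F.preimage (eqToHom (he X) ≫ f ≫ eqToHom (he Y).symm)
      map_id := fun X => F.map_injective (by simp)
      map_comp := fun f g => F.map_injective (by simp) }
  have hG : ∀ {X Y : ℬ} (f : X ⟶ Y),
      F.map (G.map f) = eqToHom (he X) ≫ f ≫ eqToHom (he Y).symm := fun f => F.map_preimage _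
  refine ⟨G, CategoryTheory.Functor.ext he' fun X Y f => F.map_injective ?_,
    CategoryTheory.Functor.ext he fun X Y f => hG f⟩
  rw [Functor.map_comp, Functor.map_comp, eqToHom_map, eqToHom_map]
  exact hG (F.map f)

section Slices

/-! ### Slice maps -/

variable {k : Type*} [Field k] {M N V W : Type*} [AddCommGroup M] [Module k M] [AddCommGroup N]
  [Module k N] [AddCommGroup V] [Module k V] [AddCommGroup W] [Module k W]

/-- The slice map `M ⊗ V → V`, `m ⊗ v ↦ f(m) v`, of a linear functional `f` on `M`. -/
def slice (f : Module.Dual k M) : M ⊗[k] V →ₗ[k] V :=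
  (TensorProduct.lid k V).toLinearMap ∘ₗ LinearMap.rTensor V f

@[simp]
theorem slice_tmul (f : Module.Dual k M) (m : M) (v : V) : slice f (m ⊗ₜ[k] v) = f m • v := by
  simp [slice]

theorem slice_add (f g : Module.Dual k M) (t : M ⊗[k] V) :
    slice (f + g) t = slice f t + slice g t := by
  simp [slice, LinearMap.rTensor_add]

theorem slice_smul (a : k) (f : Module.Dual k M) (t : M ⊗[k] V) :
    slice (a • f) t = a • slice f t := by
  simp [slice, LinearMap.rTensor_smul]

theorem slice_lTensor (f : Module.Dual k M) (g : V →ₗ[k] W) (t : M ⊗[k] V) :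
    slice f (g.lTensor M t) = g (slice f t) := by
  induction t with
  | zero => simp
  | add a b ha hb => simp only [map_add, ha, hb]
  | tmul m v => simp

theorem slice_rTensor (f : Module.Dual k N) (r : M →ₗ[k] N) (t : M ⊗[k] V) :
    slice f (r.rTensor V t) = slice (f ∘ₗ r) t := by
  induction t with
  | zero => simp
  | add a b ha hb => simp only [map_add, ha, hb]
  | tmul m v => simp

/-- The slice maps separate the elements of `M ⊗ V`. -/
theorem ext_of_slice {s t : M ⊗[k] V} (h : ∀ f : Module.Dual k M, slice f s = slice f t) :
    s = t := by
  let b := Module.Basis.ofVectorSpace k M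
  rw [← sub_eq_zero]
  obtain ⟨c, hc⟩ := TensorProduct.eq_repr_basis_left b (s - t)
  have hz : c = 0 := by
    ext i
    have hi : slice (b.coord i) (s - t) = 0 := by rw [map_sub, h, sub_self]
    rw [← hc, Finsupp.sum, map_sum] at hi
    simp only [slice_tmul, Module.Basis.coord_apply, Module.Basis.repr_self] at hi
    rw [Finset.sum_eq_single i] at hi
    · simpa using hi
    · intro j _ hj
      simp [hj]
    · intro hi'
      simpa using hi'
  rw [← hc, hz, Finsupp.sum_zero_index]

end Slices

section Push

/-! ### Corestriction of comodules along partial corepresentations -/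

variable {k : Type u} [Field k] {H : Type v} [Ring H] [HopfAlgebra k H]
  {D : Type w} [AddCommGroup D] [Module k D] [Coalgebra k D]
  {M : Type w'} [AddCommGroup M] [Module k M]

/-- The iterated coaction of `(I ⊗ ω) ρ` only involves `ρ` once: `m⁰⁰ ⊗ m⁰¹ ⊗ m¹` becomes
`m⁰ ⊗ ω(m¹₍₁₎) ⊗ ω(m¹₍₂₎)`. -/
theorem rTensor_comp_push {ρ : M →ₗ[k] M ⊗[k] D} (hρ : IsComodule k ρ) (ω : D →ₗ[k] H) :
    (ω.lTensor M ∘ₗ ρ).rTensor H ∘ₗ ω.lTensor M ∘ₗ ρ =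
      TensorProduct.map (ω.lTensor M) ω ∘ₗ rightComul k M D ∘ₗ ρ := by
  rw [← hρ.coassoc, ← LinearMap.comp_assoc, LinearMap.rTensor_comp_lTensor, ← LinearMap.comp_assoc,
    LinearMap.map_comp_rTensor]

theorem rTensor_rTensor_comp_push {ρ : M →ₗ[k] M ⊗[k] D} (hρ : IsComodule k ρ) (ω : D →ₗ[k] H) :
    ((ω.lTensor M ∘ₗ ρ).rTensor H).rTensor H ∘ₗ
        (ω.lTensor M ∘ₗ ρ).rTensor H ∘ₗ ω.lTensor M ∘ₗ ρ =
      TensorProduct.map (TensorProduct.map (ω.lTensor M) ω) ω ∘ₗ (rightComul k M D).rTensor D ∘ₗ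
        rightComul k M D ∘ₗ ρ := by
  have h1 : ((ω.lTensor M ∘ₗ ρ).rTensor H).rTensor H ∘ₗ (ω.lTensor M ∘ₗ ρ).rTensor H ∘ₗ
      ω.lTensor M = TensorProduct.map ((ω.lTensor M ∘ₗ ρ).rTensor H ∘ₗ ω.lTensor M ∘ₗ ρ) ω := by
    rw [LinearMap.rTensor_comp_lTensor, LinearMap.rTensor_comp_map]
  rw [← LinearMap.comp_assoc ρ, ← LinearMap.comp_assoc ρ, h1, rTensor_comp_push hρ,
    ← LinearMap.map_comp_rTensor, LinearMap.rTensor_comp, LinearMap.comp_assoc, LinearMap.comp_assoc,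
    hρ.coassoc]

/-- The left-hand side of the axiom `comul_left` for a coaction `(I ⊗ ω) ρ`, as a map on `M ⊗ D`.
The next three lemmas treat the other sides of `comul_left` and `comul_right`. -/
theorem comul_left_lhs (ω : D →ₗ[k] H) :
    rightMulAntipode k H (M ⊗[k] H) ∘ₗ (rightComul k M H).rTensor H ∘ₗ
        TensorProduct.map (ω.lTensor M) ω ∘ₗ rightComul k M D =
      (TensorProduct.assoc k M H H).symm.toLinearMap ∘ₗ
        (rightMulAntipode k H H ∘ₗ (Coalgebra.comul (R := k)).rTensor H ∘ₗ
          TensorProduct.map ω ω ∘ₗ Coalgebra.comul (R := k)).lTensor M := by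
  ext m d
  simp only [rightComul, AlgebraTensorModule.curry_apply, curry_apply, LinearMap.coe_restrictScalars,
    LinearMap.comp_apply, LinearMap.lTensor_tmul, LinearEquiv.coe_coe]
  generalize Coalgebra.comul (R := k) d = t
  induction t with
  | zero => simp
  | add a b ha hb => simp only [map_add, tmul_add, ha, hb]
  | tmul a b =>
    simp only [assoc_symm_tmul, map_tmul, LinearMap.lTensor_tmul, LinearMap.rTensor_tmul,
      LinearMap.comp_apply, LinearEquiv.coe_coe]
    generalize Coalgebra.comul (R := k) (ω a) = s
    induction s with
    | zero => simp
    | add a b ha hb => simp only [map_add, tmul_add, add_tmul, ha, hb]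
    | tmul x y => simp [rightMulAntipode]

theorem comul_left_rhs (ω : D →ₗ[k] H) :
    rightMulAntipode k H (M ⊗[k] H) ∘ₗ
        TensorProduct.map (TensorProduct.map (ω.lTensor M) ω) ω ∘ₗ (rightComul k M D).rTensor D ∘ₗ
          rightComul k M D =
      (TensorProduct.assoc k M H H).symm.toLinearMap ∘ₗ
        (rightMulAntipode k H H ∘ₗ TensorProduct.map (TensorProduct.map ω ω) ω ∘ₗ
          (Coalgebra.comul (R := k)).rTensor D ∘ₗ Coalgebra.comul (R := k)).lTensor M := by
  ext m d
  simp only [rightComul, AlgebraTensorModule.curry_apply, curry_apply, LinearMap.coe_restrictScalars,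
    LinearMap.comp_apply, LinearMap.lTensor_tmul, LinearEquiv.coe_coe]
  generalize Coalgebra.comul (R := k) d = t
  induction t with
  | zero => simp
  | add a b ha hb => simp only [map_add, tmul_add, ha, hb]
  | tmul a b =>
    simp only [assoc_symm_tmul, LinearMap.lTensor_tmul, LinearMap.rTensor_tmul,
      LinearMap.comp_apply, LinearEquiv.coe_coe]
    generalize Coalgebra.comul (R := k) a = s
    induction s with
    | zero => simp
    | add a b ha hb => simp only [map_add, tmul_add, add_tmul, ha, hb]
    | tmul x y => simp [rightMulAntipode]

theorem comul_right_lhs (ω : D →ₗ[k] H) :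
    (rightMulAntipode k H M).rTensor H ∘ₗ rightComul k (M ⊗[k] H) H ∘ₗ
        TensorProduct.map (ω.lTensor M) ω ∘ₗ rightComul k M D =
      (TensorProduct.assoc k M H H).symm.toLinearMap ∘ₗ
        ((mulAntipode k H).rTensor H ∘ₗ rightComul k H H ∘ₗ
          TensorProduct.map ω ω ∘ₗ Coalgebra.comul (R := k)).lTensor M := by
  ext m d
  simp only [rightComul, AlgebraTensorModule.curry_apply, curry_apply, LinearMap.coe_restrictScalars,
    LinearMap.comp_apply, LinearMap.lTensor_tmul, LinearEquiv.coe_coe]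
  generalize Coalgebra.comul (R := k) d = t
  induction t with
  | zero => simp
  | add a b ha hb => simp only [map_add, tmul_add, ha, hb]
  | tmul a b =>
    simp only [assoc_symm_tmul, map_tmul, LinearMap.lTensor_tmul]
    generalize Coalgebra.comul (R := k) (ω b) = s
    induction s with
    | zero => simp
    | add a b ha hb => simp only [map_add, tmul_add, ha, hb]
    | tmul x y => simp [rightMulAntipode]

theorem comul_right_rhs (ω : D →ₗ[k] H) :
    (rightMulAntipode k H M).rTensor H ∘ₗ
        TensorProduct.map (TensorProduct.map (ω.lTensor M) ω) ω ∘ₗ (rightComul k M D).rTensor D ∘ₗ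
          rightComul k M D =
      (TensorProduct.assoc k M H H).symm.toLinearMap ∘ₗ
        ((mulAntipode k H).rTensor H ∘ₗ TensorProduct.map (TensorProduct.map ω ω) ω ∘ₗ
          (Coalgebra.comul (R := k)).rTensor D ∘ₗ Coalgebra.comul (R := k)).lTensor M := by
  ext m d
  simp only [rightComul, AlgebraTensorModule.curry_apply, curry_apply, LinearMap.coe_restrictScalars,
    LinearMap.comp_apply, LinearMap.lTensor_tmul, LinearEquiv.coe_coe]
  generalize Coalgebra.comul (R := k) d = t
  induction t with
  | zero => simp
  | add a b ha hb => simp only [map_add, tmul_add, ha, hb]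
  | tmul a b =>
    simp only [assoc_symm_tmul, LinearMap.lTensor_tmul, LinearMap.rTensor_tmul,
      LinearMap.comp_apply, LinearEquiv.coe_coe]
    generalize Coalgebra.comul (R := k) a = s
    induction s with
    | zero => simp
    | add a b ha hb => simp only [map_add, tmul_add, add_tmul, ha, hb]
    | tmul x y => simp [rightMulAntipode]

/-- The axioms of a partial comodule for `(I ⊗ ω) ∘ ρ` are the axioms of a partial
corepresentation for `ω`, tensored with `M` and composed with the comodule structure `ρ`. -/
theorem isPartialComodule_push_iff {ρ : M →ₗ[k] M ⊗[k] D} (hρ : IsComodule k ρ) (ω : D →ₗ[k] H) :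
    IsPartialComodule k (ω.lTensor M ∘ₗ ρ) ↔
      (Coalgebra.counit (R := k) ∘ₗ ω).lTensor M ∘ₗ ρ = (Coalgebra.counit (R := k)).lTensor M ∘ₗ ρ ∧
      (rightMulAntipode k H H ∘ₗ (Coalgebra.comul (R := k)).rTensor H ∘ₗ
          TensorProduct.map ω ω ∘ₗ Coalgebra.comul (R := k)).lTensor M ∘ₗ ρ =
        (rightMulAntipode k H H ∘ₗ TensorProduct.map (TensorProduct.map ω ω) ω ∘ₗ
          (Coalgebra.comul (R := k)).rTensor D ∘ₗ Coalgebra.comul (R := k)).lTensor M ∘ₗ ρ ∧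
      ((mulAntipode k H).rTensor H ∘ₗ rightComul k H H ∘ₗ
          TensorProduct.map ω ω ∘ₗ Coalgebra.comul (R := k)).lTensor M ∘ₗ ρ =
        ((mulAntipode k H).rTensor H ∘ₗ TensorProduct.map (TensorProduct.map ω ω) ω ∘ₗ
          (Coalgebra.comul (R := k)).rTensor D ∘ₗ Coalgebra.comul (R := k)).lTensor M ∘ₗ ρ := by
  have hc : (TensorProduct.rid k M).toLinearMap ∘ₗ (Coalgebra.counit (R := k)).lTensor M ∘ₗ
        ω.lTensor M ∘ₗ ρ = LinearMap.id ↔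
      (Coalgebra.counit (R := k) ∘ₗ ω).lTensor M ∘ₗ ρ =
        (Coalgebra.counit (R := k)).lTensor M ∘ₗ ρ := by
    rw [← hρ.counit, LinearEquiv.comp_toLinearMap_eq_iff, ← LinearMap.comp_assoc,
      ← LinearMap.lTensor_comp]
  have h : ∀ {f g : D →ₗ[k] H ⊗[k] H} {f' g' : M ⊗[k] D →ₗ[k] (M ⊗[k] H) ⊗[k] H},
      f' = (TensorProduct.assoc k M H H).symm.toLinearMap ∘ₗ f.lTensor M →
      g' = (TensorProduct.assoc k M H H).symm.toLinearMap ∘ₗ g.lTensor M →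
      (f' ∘ₗ ρ = g' ∘ₗ ρ ↔ f.lTensor M ∘ₗ ρ = g.lTensor M ∘ₗ ρ) := by
    rintro f g f' g' rfl rfl
    rw [LinearMap.comp_assoc, LinearMap.comp_assoc, LinearEquiv.comp_toLinearMap_eq_iff]
  rw [← hc, ← h (comul_left_lhs ω) (comul_left_rhs ω), ← h (comul_right_lhs ω) (comul_right_rhs ω)]
  simp only [LinearMap.comp_assoc]
  rw [← rTensor_comp_push hρ, ← rTensor_rTensor_comp_push hρ]
  exact ⟨fun h => ⟨h.counit, h.comul_left, h.comul_right⟩, fun h => ⟨h.1, h.2.1, h.2.2⟩⟩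

theorem IsPartialCorep.isPartialComodule_push {ω : D →ₗ[k] H} (hω : IsPartialCorep k ω)
    {ρ : M →ₗ[k] M ⊗[k] D} (hρ : IsComodule k ρ) : IsPartialComodule k (ω.lTensor M ∘ₗ ρ) :=
  (isPartialComodule_push_iff hρ ω).2
    ⟨by rw [hω.counit_comp], by rw [hω.comul_left], by rw [hω.comul_right]⟩

/-- If the coefficients `f(m⁰) m¹` span `D`, a linear map `g` on `D` is determined by
`m ↦ m⁰ ⊗ g(m¹)`. -/
theorem ext_of_span_slice {D V M : Type*} [AddCommGroup D] [Module k D] [AddCommGroup V]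
    [Module k V] [AddCommGroup M] [Module k M] {ρ : M →ₗ[k] M ⊗[k] D}
    (hspan : Submodule.span k {d | ∃ f m, slice f (ρ m) = d} = ⊤) {g g' : D →ₗ[k] V}
    (h : g.lTensor M ∘ₗ ρ = g'.lTensor M ∘ₗ ρ) : g = g' := by
  refine LinearMap.ext_on hspan ?_
  rintro _ ⟨f, m, rfl⟩
  rw [← slice_lTensor, ← slice_lTensor]
  exact congrArg (slice f) (LinearMap.congr_fun h m)

/-- If the coefficients of a comodule span the coalgebra, then `ω` is a partial corepresentation as
soon as it turns the comodule into a partial comodule. -/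
theorem IsPartialComodule.isPartialCorep {ω : D →ₗ[k] H} {ρ : M →ₗ[k] M ⊗[k] D}
    (h : IsPartialComodule k (ω.lTensor M ∘ₗ ρ)) (hρ : IsComodule k ρ)
    (hspan : Submodule.span k {d | ∃ f m, slice f (ρ m) = d} = ⊤) : IsPartialCorep k ω :=
  have h' := (isPartialComodule_push_iff hρ ω).1 h
  ⟨ext_of_span_slice hspan h'.1, ext_of_span_slice hspan h'.2.1, ext_of_span_slice hspan h'.2.2⟩

end Push

section Comodules

/-! ### Comodules -/

variable {k : Type*} [Field k] {C D : Type*} [AddCommGroup C] [Module k C] [Coalgebra k C]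
  [AddCommGroup D] [Module k D] [Coalgebra k D]
  {M N : Type*} [AddCommGroup M] [Module k M] [AddCommGroup N] [Module k N]

theorem IsComodule.lTensor_counit {ρ : M →ₗ[k] M ⊗[k] C} (hρ : IsComodule k ρ) (m : M) :
    (Coalgebra.counit (R := k)).lTensor M (ρ m) = m ⊗ₜ[k] 1 := by
  apply (TensorProduct.rid k M).injective
  rw [rid_tmul, one_smul]
  exact LinearMap.congr_fun hρ.counit m

theorem IsComodule.lTensor_comul {ρ : M →ₗ[k] M ⊗[k] C} (hρ : IsComodule k ρ) :
    (Coalgebra.comul (R := k)).lTensor M ∘ₗ ρ =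
      (TensorProduct.assoc k M C C).toLinearMap ∘ₗ ρ.rTensor C ∘ₗ ρ := by
  rw [hρ.coassoc, rightComul, LinearMap.comp_assoc, ← LinearMap.comp_assoc _ _
    (TensorProduct.assoc k M C C).toLinearMap, LinearEquiv.comp_symm, LinearMap.id_comp]

/-- The comultiplication makes a coalgebra a comodule over itself. -/
theorem isComodule_comul : IsComodule k (Coalgebra.comul (R := k) (A := C)) where
  counit := by
    rw [Coalgebra.lTensor_counit_comp_comul]
    ext x
    simp
  coassoc := by
    rw [rightComul, LinearMap.comp_assoc, ← Coalgebra.coassoc]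
    ext x
    simp

theorem map_lTensor_comp_rightComul (g : C →ₗc[k] D) :
    TensorProduct.map (g.toLinearMap.lTensor M) g.toLinearMap ∘ₗ rightComul k M C =
      rightComul k M D ∘ₗ g.toLinearMap.lTensor M := by
  rw [rightComul, rightComul, LinearMap.comp_assoc, ← LinearMap.lTensor_comp, ← g.map_comp_comul,
    LinearMap.lTensor_comp, ← LinearMap.comp_assoc, ← LinearMap.comp_assoc]
  congr 1
  ext
  simp

/-- A comodule over `C` becomes a comodule over `D` along a morphism of coalgebras `C → D`. -/
theorem IsComodule.push {ρ : M →ₗ[k] M ⊗[k] C} (hρ : IsComodule k ρ) (g : C →ₗc[k] D) :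
    IsComodule k (g.toLinearMap.lTensor M ∘ₗ ρ) where
  counit := by
    rw [← LinearMap.comp_assoc ρ, ← LinearMap.lTensor_comp, g.counit_comp]
    exact hρ.counit
  coassoc := by
    rw [← LinearMap.comp_assoc ρ, LinearMap.rTensor_comp_lTensor, ← LinearMap.map_comp_rTensor,
      LinearMap.comp_assoc, hρ.coassoc, ← LinearMap.comp_assoc, map_lTensor_comp_rightComul]
    rfl

/-- A comodule structure is transported along a linear isomorphism. -/
theorem IsComodule.congr {ρ : M →ₗ[k] M ⊗[k] C} (hρ : IsComodule k ρ) (e : M ≃ₗ[k] N) :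
    IsComodule k (e.toLinearMap.rTensor C ∘ₗ ρ ∘ₗ e.symm.toLinearMap) where
  counit := by
    ext n
    have h := hρ.lTensor_counit (e.symm n)
    simp only [LinearMap.comp_apply, LinearEquiv.coe_coe, LinearMap.id_apply]
    rw [← LinearMap.comp_apply (LinearMap.lTensor N _), LinearMap.lTensor_comp_rTensor,
      ← LinearMap.rTensor_comp_lTensor, LinearMap.comp_apply, h]
    simp
  coassoc := by
    have h1 : rightComul k N C ∘ₗ e.toLinearMap.rTensor C =
        (e.toLinearMap.rTensor C).rTensor C ∘ₗ rightComul k M C := by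
      ext m c
      simp only [rightComul, AlgebraTensorModule.curry_apply, curry_apply,
        LinearMap.coe_restrictScalars, LinearMap.comp_apply, LinearMap.lTensor_tmul,
        LinearMap.rTensor_tmul, LinearEquiv.coe_coe]
      generalize Coalgebra.comul (R := k) c = t
      induction t with
      | zero => simp
      | add a b ha hb => simp only [map_add, tmul_add, ha, hb]
      | tmul a b => simp
    rw [← LinearMap.comp_assoc, ← LinearMap.comp_assoc (_ ∘ₗ _), h1,
      LinearMap.comp_assoc _ (rightComul k M C), ← LinearMap.comp_assoc _ ρ (rightComul k M C),
      ← hρ.coassoc, ← LinearMap.rTensor_comp]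
    have h2 : (e.toLinearMap.rTensor C ∘ₗ ρ ∘ₗ e.symm.toLinearMap) ∘ₗ e.toLinearMap =
        e.toLinearMap.rTensor C ∘ₗ ρ := by
      ext
      simp
    rw [h2, LinearMap.rTensor_comp]
    rfl

/-- Let `q` be a linear map on a coalgebra `D` whose kernel contains no nonzero coideal. Then a
linear map between `D`-comodules is colinear as soon as it is so after composing the coactions
with `q`: the differences of the coefficients `ψ(f(m)⁰) f(m)¹` and `ψ(f(m⁰)) m¹` span a coideal
in the kernel of `q`. -/
theorem IsComodule.colinear_of_push {H : Type*} [AddCommGroup H] [Module k H] {q : D →ₗ[k] H}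
    (hq : ∀ I : Submodule k D, I.IsCoideal → I ≤ LinearMap.ker q → I = ⊥)
    {ρ : M →ₗ[k] M ⊗[k] D} (hρ : IsComodule k ρ) {σ : N →ₗ[k] N ⊗[k] D} (hσ : IsComodule k σ)
    (f : M →ₗ[k] N)
    (hf : (q.lTensor N ∘ₗ σ) ∘ₗ f = f.rTensor H ∘ₗ q.lTensor M ∘ₗ ρ) :
    σ ∘ₗ f = f.rTensor D ∘ₗ ρ := by
  let I : Submodule k D := Submodule.span k
    {d | ∃ (ψ : Module.Dual k N) (m : M), slice ψ (σ (f m)) - slice ψ (f.rTensor D (ρ m)) = d}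
  let π := I.mkQ
  -- Modulo `I`, the map `f` is colinear.
  have hπ : π.lTensor N ∘ₗ σ ∘ₗ f = f.rTensor (D ⧸ I) ∘ₗ π.lTensor M ∘ₗ ρ := by
    ext m
    rw [← LinearMap.comp_assoc ρ, LinearMap.rTensor_comp_lTensor, ← LinearMap.lTensor_comp_rTensor]
    refine ext_of_slice fun ψ => ?_
    simp only [LinearMap.comp_apply, slice_lTensor]
    exact (Submodule.Quotient.eq I).2 (Submodule.subset_span ⟨ψ, m, rfl⟩)
  have hΔ : (TensorProduct.map π π ∘ₗ Coalgebra.comul (R := k)).lTensor N ∘ₗ σ ∘ₗ f =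
      (TensorProduct.map π π ∘ₗ Coalgebra.comul (R := k)).lTensor N ∘ₗ f.rTensor D ∘ₗ ρ := by
    have a1 : (TensorProduct.map π π).lTensor N ∘ₗ (TensorProduct.assoc k N D D).toLinearMap =
        (TensorProduct.assoc k N _ _).toLinearMap ∘ₗ TensorProduct.map (π.lTensor N) π := by
      ext
      simp
    have a2 : (TensorProduct.assoc k N _ _).toLinearMap ∘ₗ
        TensorProduct.map (f.rTensor (D ⧸ I) ∘ₗ π.lTensor M) π =
          f.rTensor _ ∘ₗ (TensorProduct.map π π).lTensor M ∘ₗ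
            (TensorProduct.assoc k M D D).toLinearMap := by
      ext
      simp
    calc
      _ = (TensorProduct.map π π).lTensor N ∘ₗ
            ((Coalgebra.comul (R := k)).lTensor N ∘ₗ σ) ∘ₗ f := by
        rw [LinearMap.lTensor_comp]
        rfl
      _ = ((TensorProduct.map π π).lTensor N ∘ₗ (TensorProduct.assoc k N D D).toLinearMap) ∘ₗ
            σ.rTensor D ∘ₗ σ ∘ₗ f := by
        rw [hσ.lTensor_comul]
        rfl
      _ = (TensorProduct.assoc k N _ _).toLinearMap ∘ₗ (TensorProduct.map (π.lTensor N) π ∘ₗ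
            σ.rTensor D) ∘ₗ σ ∘ₗ f := by
        rw [a1]
        rfl
      _ = (TensorProduct.assoc k N _ _).toLinearMap ∘ₗ (π.lTensor N ∘ₗ σ).rTensor _ ∘ₗ
            (π.lTensor N ∘ₗ σ ∘ₗ f) := by
        rw [LinearMap.map_comp_rTensor, ← LinearMap.rTensor_comp_lTensor]
        rfl
      _ = (TensorProduct.assoc k N _ _).toLinearMap ∘ₗ ((π.lTensor N ∘ₗ σ).rTensor _ ∘ₗ
            f.rTensor _ ∘ₗ π.lTensor M) ∘ₗ ρ := by
        rw [hπ]
        rfl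
      _ = (TensorProduct.assoc k N _ _).toLinearMap ∘ₗ
            TensorProduct.map (π.lTensor N ∘ₗ σ ∘ₗ f) π ∘ₗ ρ := by
        rw [LinearMap.rTensor_comp_lTensor, LinearMap.rTensor_comp_map]
        rfl
      _ = ((TensorProduct.assoc k N _ _).toLinearMap ∘ₗ
            TensorProduct.map (f.rTensor (D ⧸ I) ∘ₗ π.lTensor M) π) ∘ₗ ρ.rTensor D ∘ₗ ρ := by
        rw [hπ, ← LinearMap.comp_assoc ρ (π.lTensor M) (f.rTensor _), ← LinearMap.map_comp_rTensor]
        rfl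
      _ = f.rTensor _ ∘ₗ (TensorProduct.map π π).lTensor M ∘ₗ
            ((TensorProduct.assoc k M D D).toLinearMap ∘ₗ ρ.rTensor D ∘ₗ ρ) := by
        rw [a2]
        rfl
      _ = (f.rTensor _ ∘ₗ (TensorProduct.map π π ∘ₗ Coalgebra.comul (R := k)).lTensor M) ∘ₗ ρ := by
        rw [← hρ.lTensor_comul, LinearMap.lTensor_comp]
        rfl
      _ = _ := by
        rw [LinearMap.rTensor_comp_lTensor, ← LinearMap.lTensor_comp_rTensor]
        rfl
  -- `hΔ` is the compatibility of `I` with the comultiplication, before slicing.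
  have hI : I.IsCoideal := by
    refine ⟨fun x hx => ?_, fun x hx => ?_⟩
    · suffices h : I ≤ LinearMap.ker (Coalgebra.counit (R := k)) from h hx
      refine Submodule.span_le.2 ?_
      rintro _ ⟨ψ, m, rfl⟩
      rw [SetLike.mem_coe, LinearMap.mem_ker, map_sub, ← slice_lTensor, ← slice_lTensor,
        hσ.lTensor_counit, ← LinearMap.comp_apply (LinearMap.lTensor N _), LinearMap.lTensor_comp_rTensor,
        ← LinearMap.rTensor_comp_lTensor, LinearMap.comp_apply, hρ.lTensor_counit,
        LinearMap.rTensor_tmul, sub_self]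
    · suffices h : I ≤ LinearMap.ker (TensorProduct.map π π ∘ₗ Coalgebra.comul (R := k)) from h hx
      refine Submodule.span_le.2 ?_
      rintro _ ⟨ψ, m, rfl⟩
      rw [SetLike.mem_coe, LinearMap.mem_ker, map_sub, ← slice_lTensor, ← slice_lTensor]
      exact sub_eq_zero.2 (congrArg (slice ψ) (LinearMap.congr_fun hΔ m))
  have hIq : I ≤ LinearMap.ker q := by
    refine Submodule.span_le.2 ?_
    rintro _ ⟨ψ, m, rfl⟩
    rw [← LinearMap.comp_assoc, LinearMap.rTensor_comp_lTensor,
      ← LinearMap.lTensor_comp_rTensor] at hf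
    rw [SetLike.mem_coe, LinearMap.mem_ker, map_sub, ← slice_lTensor, ← slice_lTensor]
    exact sub_eq_zero.2 (congrArg (slice ψ) (LinearMap.congr_fun hf m))
  have hbot := hq I hI hIq
  ext m
  refine ext_of_slice fun ψ => sub_eq_zero.1 ?_
  have hmem : slice ψ (σ (f m)) - slice ψ (f.rTensor D (ρ m)) ∈ I :=
    Submodule.subset_span ⟨ψ, m, rfl⟩
  rwa [hbot, Submodule.mem_bot] at hmem

end Comodules

section Corepresentations

/-! ### The universal corep-coalgebra -/

variable {k : Type u} [Field k] {H : Type v} [Ring H] [HopfAlgebra k H]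
  {C : Type w} [AddCommGroup C] [Module k C] [Coalgebra k C]
  {D : Type w'} [AddCommGroup D] [Module k D] [Coalgebra k D]

/-- For a morphism of coalgebras `g : D → C`, the axioms of a partial corepresentation for `ω ∘ g`
are those for `ω`, composed with `g`. -/
theorem isPartialCorep_comp_iff (ω : C →ₗ[k] H) (g : D →ₗc[k] C) :
    IsPartialCorep k (ω ∘ₗ g.toLinearMap) ↔
      (Coalgebra.counit (R := k) ∘ₗ ω) ∘ₗ g.toLinearMap =
        Coalgebra.counit (R := k) ∘ₗ g.toLinearMap ∧
      (rightMulAntipode k H H ∘ₗ (Coalgebra.comul (R := k)).rTensor H ∘ₗ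
          TensorProduct.map ω ω ∘ₗ Coalgebra.comul (R := k)) ∘ₗ g.toLinearMap =
        (rightMulAntipode k H H ∘ₗ TensorProduct.map (TensorProduct.map ω ω) ω ∘ₗ
          (Coalgebra.comul (R := k)).rTensor C ∘ₗ Coalgebra.comul (R := k)) ∘ₗ g.toLinearMap ∧
      ((mulAntipode k H).rTensor H ∘ₗ rightComul k H H ∘ₗ
          TensorProduct.map ω ω ∘ₗ Coalgebra.comul (R := k)) ∘ₗ g.toLinearMap =
        ((mulAntipode k H).rTensor H ∘ₗ TensorProduct.map (TensorProduct.map ω ω) ω ∘ₗ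
          (Coalgebra.comul (R := k)).rTensor C ∘ₗ Coalgebra.comul (R := k)) ∘ₗ
            g.toLinearMap := by
  have h1 : TensorProduct.map (ω ∘ₗ g.toLinearMap) (ω ∘ₗ g.toLinearMap) ∘ₗ
      Coalgebra.comul (R := k) =
        TensorProduct.map ω ω ∘ₗ Coalgebra.comul (R := k) ∘ₗ g.toLinearMap := by
    rw [TensorProduct.map_comp, LinearMap.comp_assoc, g.map_comp_comul]
  have h2 : TensorProduct.map (TensorProduct.map (ω ∘ₗ g.toLinearMap) (ω ∘ₗ g.toLinearMap))
      (ω ∘ₗ g.toLinearMap) ∘ₗ (Coalgebra.comul (R := k)).rTensor D ∘ₗ Coalgebra.comul (R := k) =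
        TensorProduct.map (TensorProduct.map ω ω) ω ∘ₗ (Coalgebra.comul (R := k)).rTensor C ∘ₗ
          Coalgebra.comul (R := k) ∘ₗ g.toLinearMap := by
    rw [← LinearMap.comp_assoc, LinearMap.map_comp_rTensor, h1,
      ← LinearMap.comp_assoc g.toLinearMap _ (TensorProduct.map ω ω), TensorProduct.map_comp,
      LinearMap.comp_assoc (Coalgebra.comul (R := k)) (TensorProduct.map g.toLinearMap _),
      g.map_comp_comul, ← LinearMap.map_comp_rTensor]
    rfl
  simp only [LinearMap.comp_assoc]
  rw [← h1, ← h2, g.counit_comp]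
  exact ⟨fun h => ⟨h.counit_comp, h.comul_left, h.comul_right⟩, fun h => ⟨h.1, h.2.1, h.2.2⟩⟩

theorem IsPartialCorep.of_surjective {ω : C →ₗ[k] H} (g : D →ₗc[k] C)
    (hg : Function.Surjective g.toLinearMap) (h : IsPartialCorep k (ω ∘ₗ g.toLinearMap)) :
    IsPartialCorep k ω :=
  have h' := (isPartialCorep_comp_iff ω g).1 h
  ⟨(LinearMap.cancel_right hg).1 h'.1, (LinearMap.cancel_right hg).1 h'.2.1,
    (LinearMap.cancel_right hg).1 h'.2.2⟩

/-- Linear maps on the cofree coalgebra that agree on the summands of `H^par` agree on `H^par`. -/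
theorem comp_incl_hpar_ext {W : Type*} [AddCommGroup W] [Module k W]
    (a b : CofreeCoalgebra k H →ₗ[k] W)
    (h : ∀ X : Subcoalgebra k (CofreeCoalgebra k H),
      IsPartialCorep k (cofreeProj k H ∘ₗ X.carrier.subtype) →
        a ∘ₗ X.incl.toLinearMap = b ∘ₗ X.incl.toLinearMap) :
    a ∘ₗ (Hpar k H).incl.toLinearMap = b ∘ₗ (Hpar k H).incl.toLinearMap := by
  have hle : (Hpar k H).carrier ≤ LinearMap.eqLocus a b :=
    iSup₂_le fun X hX x hx => LinearMap.congr_fun (h X hX) ⟨x, hx⟩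
  ext x
  exact hle x.2

variable (k H) in
/-- The projection `p : H^par → H` is a partial corepresentation: each axiom is an equality of
linear maps, so it may be checked on the summands of `H^par`. -/
theorem isPartialCorep_hparProj : IsPartialCorep k (hparProj k H) :=
  (isPartialCorep_comp_iff (cofreeProj k H) (Hpar k H).incl).2
    ⟨comp_incl_hpar_ext _ _ fun X hX =>
      ((isPartialCorep_comp_iff (cofreeProj k H) X.incl).1 hX).1,
    comp_incl_hpar_ext _ _ fun X hX =>
      ((isPartialCorep_comp_iff (cofreeProj k H) X.incl).1 hX).2.1,
    comp_incl_hpar_ext _ _ fun X hX =>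
      ((isPartialCorep_comp_iff (cofreeProj k H) X.incl).1 hX).2.2⟩

/-- Every partial corepresentation factors through the universal one by a morphism of
coalgebras. -/
theorem IsPartialCorep.exists_lift {ω : D →ₗ[k] H} (h : IsPartialCorep k ω) :
    ∃ g : D →ₗc[k] (Hpar k H).carrier, hparProj k H ∘ₗ g.toLinearMap = ω := by
  let g := CofreeCoalgebra.lift ω
  have hg : cofreeProj k H ∘ₗ g.toLinearMap = ω := CofreeCoalgebra.proj_lift ω
  let X := Subcoalgebra.range g
  have hX : IsPartialCorep k (cofreeProj k H ∘ₗ X.carrier.subtype) := by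
    refine IsPartialCorep.of_surjective (X.codRestrict g fun x => ⟨x, rfl⟩) ?_ ?_
    · rintro ⟨_, x, rfl⟩
      exact ⟨x, rfl⟩
    · convert h using 1
      exact hg
  have hle : X.carrier ≤ (Hpar k H).carrier := le_iSup₂_of_le X hX le_rfl
  exact ⟨(Hpar k H).codRestrict g fun x => hle ⟨x, rfl⟩, hg⟩

variable (k H) in
/-- The kernel of `p : H^par → H` contains no nonzero coideal `I`: the inclusion of `H^par` into
the cofree coalgebra factors through `H^par / I`. -/
theorem eq_bot_of_isCoideal_of_le_ker_hparProj (I : Submodule k (Hpar k H).carrier)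
    (hI : I.IsCoideal) (hle : I ≤ LinearMap.ker (hparProj k H)) : I = ⊥ := by
  let g := CofreeCoalgebra.lift (I.liftQ (hparProj k H) hle)
  have hg : cofreeProj k H ∘ₗ g.toLinearMap = I.liftQ (hparProj k H) hle :=
    CofreeCoalgebra.proj_lift _
  have h : g.comp (Coalgebra.Quotient.mkQCoalgHom I) = (Hpar k H).incl := by
    refine (CofreeCoalgebra.existsUnique_lift (hparProj k H)).unique ?_ rfl
    refine Eq.trans ?_ (I.liftQ_mkQ (hparProj k H) hle)
    exact congrArg (· ∘ₗ I.mkQ) hg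
  refine (Submodule.eq_bot_iff I).2 fun x hx => Subtype.ext ?_
  have hx0 : I.mkQ x = 0 := (Submodule.Quotient.mk_eq_zero I).2 hx
  have h' : g (I.mkQ x) = (x : CofreeCoalgebra k H) := DFunLike.congr_fun h x
  rw [← h', hx0]
  exact map_zero g.toLinearMap

/-- A linear map between `H^par`-comodules that is a morphism of the associated partial comodules
is colinear. -/
theorem colinear_of_colinear_hparProj {M N : Type*} [AddCommGroup M] [Module k M]
    [AddCommGroup N] [Module k N] {ρ : M →ₗ[k] M ⊗[k] (Hpar k H).carrier} (hρ : IsComodule k ρ)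
    {σ : N →ₗ[k] N ⊗[k] (Hpar k H).carrier} (hσ : IsComodule k σ) (f : M →ₗ[k] N)
    (hf : ((hparProj k H).lTensor N ∘ₗ σ) ∘ₗ f =
      f.rTensor H ∘ₗ (hparProj k H).lTensor M ∘ₗ ρ) :
    σ ∘ₗ f = f.rTensor _ ∘ₗ ρ :=
  hρ.colinear_of_push (eq_bot_of_isCoideal_of_le_ker_hparProj k H) hσ f hf

/-- An `H^par`-comodule structure is determined by the associated partial comodule. -/
theorem eq_of_lTensor_hparProj_eq {M : Type*} [AddCommGroup M] [Module k M]
    {ρ σ : M →ₗ[k] M ⊗[k] (Hpar k H).carrier} (hρ : IsComodule k ρ) (hσ : IsComodule k σ)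
    (h : (hparProj k H).lTensor M ∘ₗ ρ = (hparProj k H).lTensor M ∘ₗ σ) : ρ = σ := by
  simpa using (colinear_of_colinear_hparProj hρ hσ LinearMap.id (by simpa using h.symm)).symm

end Corepresentations

section Coend

/-! ### The coalgebra `M^* ⊗_R M` -/

variable {k : Type*} [Field k] {M V : Type*} [AddCommGroup M] [Module k M]
  [AddCommGroup V] [Module k V]

section

variable {Q W : Type*} [AddCommGroup Q] [Module k Q] [AddCommGroup W] [Module k W]
  {d : M →ₗ[k] M ⊗[k] Q} {Δ : Q →ₗ[k] Q ⊗[k] Q}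

/-- A map applied to the second leg of `Δ` amounts to a map applied to the outer coaction. -/
theorem lTensor_lTensor_comp_coaction
    (hΔ : Δ.lTensor M ∘ₗ d = (TensorProduct.assoc k M Q Q).toLinearMap ∘ₗ d.rTensor Q ∘ₗ d)
    (g : Q →ₗ[k] W) :
    (g.lTensor Q ∘ₗ Δ).lTensor M ∘ₗ d =
      (TensorProduct.assoc k M Q W).toLinearMap ∘ₗ d.rTensor W ∘ₗ g.lTensor M ∘ₗ d := by
  have h : (g.lTensor Q).lTensor M ∘ₗ (TensorProduct.assoc k M Q Q).toLinearMap =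
      (TensorProduct.assoc k M Q W).toLinearMap ∘ₗ g.lTensor (M ⊗[k] Q) := by
    ext
    simp
  rw [LinearMap.lTensor_comp, LinearMap.comp_assoc, hΔ, ← LinearMap.comp_assoc, h,
    LinearMap.comp_assoc, ← LinearMap.comp_assoc d (d.rTensor Q),
    LinearMap.lTensor_comp_rTensor, ← LinearMap.rTensor_comp_lTensor]
  rfl

/-- A map applied to the first leg of `Δ` amounts to a map applied to the inner coaction. -/
theorem lTensor_rTensor_comp_coaction
    (hΔ : Δ.lTensor M ∘ₗ d = (TensorProduct.assoc k M Q Q).toLinearMap ∘ₗ d.rTensor Q ∘ₗ d)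
    (g : Q →ₗ[k] W) :
    (g.rTensor Q ∘ₗ Δ).lTensor M ∘ₗ d =
      (TensorProduct.assoc k M W Q).toLinearMap ∘ₗ (g.lTensor M ∘ₗ d).rTensor Q ∘ₗ d := by
  have h : (g.rTensor Q).lTensor M ∘ₗ (TensorProduct.assoc k M Q Q).toLinearMap =
      (TensorProduct.assoc k M W Q).toLinearMap ∘ₗ (g.lTensor M).rTensor Q := by
    ext
    simp
  rw [LinearMap.lTensor_comp, LinearMap.comp_assoc, hΔ, ← LinearMap.comp_assoc, h,
    LinearMap.rTensor_comp]
  rfl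

end

/-- Let the coefficients of `d : M → M ⊗ Q` span `Q`. Linear maps `Δ` and `ε` on `Q` for which
`d` satisfies the axioms of a comodule are then a coalgebra structure. -/
theorem exists_coalgebra_of_span {Q : Type*} [AddCommGroup Q] [Module k Q] {d : M →ₗ[k] M ⊗[k] Q}
    (hspan : Submodule.span k {q | ∃ f m, slice f (d m) = q} = ⊤)
    {Δ : Q →ₗ[k] Q ⊗[k] Q} {ε : Q →ₗ[k] k}
    (hΔ : Δ.lTensor M ∘ₗ d = (TensorProduct.assoc k M Q Q).toLinearMap ∘ₗ d.rTensor Q ∘ₗ d)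
    (hε : ε.lTensor M ∘ₗ d = (TensorProduct.mk k M k).flip 1) :
    ∃ _ : Coalgebra k Q, IsComodule k d := by
  let C : Coalgebra k Q :=
    { comul := Δ
      counit := ε
      coassoc := by
        refine ext_of_span_slice hspan ?_
        have h : (TensorProduct.assoc k Q Q Q).toLinearMap.lTensor M ∘ₗ
            (TensorProduct.assoc k M (Q ⊗[k] Q) Q).toLinearMap ∘ₗ
              (TensorProduct.assoc k M Q Q).toLinearMap.rTensor Q ∘ₗ (d.rTensor Q).rTensor Q =
            (TensorProduct.assoc k M Q (Q ⊗[k] Q)).toLinearMap ∘ₗ d.rTensor (Q ⊗[k] Q) ∘ₗ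
              (TensorProduct.assoc k M Q Q).toLinearMap := by
          ext m q r
          simp only [AlgebraTensorModule.curry_apply, curry_apply, LinearMap.coe_restrictScalars,
            LinearMap.comp_apply, LinearMap.rTensor_tmul, LinearEquiv.coe_coe, assoc_tmul]
          induction d m with
          | zero => simp
          | add a b ha hb => simp only [map_add, add_tmul, ha, hb]
          | tmul a b => simp
        rw [lTensor_lTensor_comp_coaction hΔ, LinearMap.lTensor_comp, LinearMap.comp_assoc,
          lTensor_rTensor_comp_coaction hΔ, hΔ, LinearMap.rTensor_comp,
          LinearMap.rTensor_comp]
        exact congrArg (· ∘ₗ d.rTensor Q ∘ₗ d) h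
      rTensor_counit_comp_comul := by
        refine ext_of_span_slice hspan ?_
        rw [lTensor_rTensor_comp_coaction hΔ, hε, ← LinearMap.comp_assoc]
        congr 1
        ext
        simp
      lTensor_counit_comp_comul := by
        refine ext_of_span_slice hspan ?_
        rw [lTensor_lTensor_comp_coaction hΔ, hε]
        ext m
        simp only [LinearMap.comp_apply, LinearMap.flip_apply, mk_apply, LinearMap.rTensor_tmul,
          LinearEquiv.coe_coe]
        induction d m with
        | zero => simp
        | add a b ha hb => simp only [map_add, add_tmul, ha, hb]
        | tmul a b => simp }
  refine ⟨C, ?_, ?_⟩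
  · change (TensorProduct.rid k M).toLinearMap ∘ₗ ε.lTensor M ∘ₗ d = LinearMap.id
    rw [hε]
    ext
    simp
  · change d.rTensor Q ∘ₗ d = ((TensorProduct.assoc k M Q Q).symm.toLinearMap ∘ₗ Δ.lTensor M) ∘ₗ d
    rw [LinearMap.comp_assoc, hΔ, ← LinearMap.comp_assoc, LinearEquiv.symm_comp, LinearMap.id_comp]

/-- The subspace of `M ⊗ M^*` spanned by all `m ⊗ f r - r m ⊗ f` with `r ∈ R`. -/
def coendRel (R : Set (Module.End k M)) : Submodule k (M ⊗[k] Module.Dual k M) :=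
  Submodule.span k {x | ∃ r ∈ R, ∃ (f : Module.Dual k M) (m : M),
    m ⊗ₜ[k] (f ∘ₗ r) - r m ⊗ₜ[k] f = x}

/-- The quotient `M^* ⊗_R M` of `M^* ⊗ M`, for a set `R` of endomorphisms of `M`. It is encoded
with the two tensor factors exchanged. -/
abbrev Coend (R : Set (Module.End k M)) := (M ⊗[k] Module.Dual k M) ⧸ coendRel R

/-- The class of `f ⊗ m` in `M^* ⊗_R M`. -/
def Coend.mk (R : Set (Module.End k M)) : Module.Dual k M →ₗ[k] M →ₗ[k] Coend R :=
  ((TensorProduct.mk k M (Module.Dual k M)).compr₂ (coendRel R).mkQ).flip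

variable {R : Set (Module.End k M)}

theorem Coend.mk_comp {r : Module.End k M} (hr : r ∈ R) (f : Module.Dual k M) (m : M) :
    Coend.mk R (f ∘ₗ r) m = Coend.mk R f (r m) :=
  (Submodule.Quotient.eq _).2 (Submodule.subset_span ⟨r, hr, f, m, rfl⟩)

/-- If `R` consists of operators of finite rank and `R M` spans `M`, then there is a linear map
`M → M ⊗ (M^* ⊗_R M)` with coefficients `f ⊗ m`. If `r = ∑ eᵢ ⊗ fᵢ`, it maps `r n` to
`∑ eᵢ ⊗ [fᵢ ⊗ n]`. -/
theorem Coend.exists_coaction (hfin : ∀ r ∈ R, ∃ t, finiteRankEnd M t = r)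
    (hRM : Submodule.span k {x | ∃ r ∈ R, ∃ m : M, r m = x} = ⊤) :
    ∃ d : M →ₗ[k] M ⊗[k] Coend R, ∀ f m, slice f (d m) = Coend.mk R f m := by
  have h : ∀ m, ∃ t : M ⊗[k] Coend R, ∀ f, slice f t = Coend.mk R f m := by
    intro m
    have hm : m ∈ Submodule.span k {x | ∃ r ∈ R, ∃ m : M, r m = x} := hRM ▸ Submodule.mem_top
    induction hm using Submodule.span_induction with
    | mem x hx =>
      obtain ⟨r, hr, n, rfl⟩ := hx
      obtain ⟨t, ht⟩ := hfin r hr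
      -- Slicing by `f` turns `∑ eᵢ ⊗ fᵢ` into `∑ f(eᵢ) fᵢ = f r`.
      refine ⟨((Coend.mk R).flip n).lTensor M t, fun f => ?_⟩
      have hs : ∀ s : M ⊗[k] Module.Dual k M, slice f s = f ∘ₗ finiteRankEnd M s := by
        intro s
        induction s with
        | zero => simp
        | add a b ha hb => rw [map_add, map_add, ha, hb, LinearMap.comp_add]
        | tmul e g =>
          ext
          simp [finiteRankEnd, mul_comm]
      rw [slice_lTensor, LinearMap.flip_apply, ← Coend.mk_comp hr, hs, ht]
    | zero => exact ⟨0, fun f => by simp⟩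
    | add x y _ _ hx hy =>
      obtain ⟨s, hs⟩ := hx
      obtain ⟨t, ht⟩ := hy
      exact ⟨s + t, fun f => by rw [map_add, map_add, hs, ht]⟩
    | smul a x _ hx =>
      obtain ⟨s, hs⟩ := hx
      exact ⟨a • s, fun f => by rw [map_smul, map_smul, hs]⟩
  -- The slice maps are jointly injective, so the chosen preimages depend linearly on `m`.
  choose d hd using h
  exact ⟨{ toFun := d
           map_add' := fun x y => ext_of_slice fun f => by simp only [map_add, hd]
           map_smul' := fun a x => ext_of_slice fun f => by simp [hd] }, fun f m => hd m f⟩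

theorem Coend.span_slice {d : M →ₗ[k] M ⊗[k] Coend R} (hd : ∀ f m, slice f (d m) = Coend.mk R f m) :
    Submodule.span k {q | ∃ f m, slice f (d m) = q} = ⊤ := by
  have h : ∀ t, (coendRel R).mkQ t ∈ Submodule.span k {q | ∃ f m, slice f (d m) = q} := by
    intro t
    induction t with
    | zero => simp
    | add a b ha hb => rw [map_add]; exact add_mem ha hb
    | tmul m f => exact Submodule.subset_span ⟨f, m, hd f m⟩
  refine Submodule.eq_top_iff'.2 fun q => ?_
  obtain ⟨t, rfl⟩ := (coendRel R).mkQ_surjective q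
  exact h t

/-- The universal property of `M^* ⊗_R M`: linear maps `M → M ⊗ V` that commute with `R` factor
through the coaction. -/
theorem Coend.exists_factor {d : M →ₗ[k] M ⊗[k] Coend R}
    (hd : ∀ f m, slice f (d m) = Coend.mk R f m) (τ : M →ₗ[k] M ⊗[k] V)
    (hτ : ∀ r ∈ R, τ ∘ₗ r = r.rTensor V ∘ₗ τ) :
    ∃ g : Coend R →ₗ[k] V, g.lTensor M ∘ₗ d = τ := by
  let g₀ : M ⊗[k] Module.Dual k M →ₗ[k] V := TensorProduct.lift
    (LinearMap.mk₂ k (fun m f => slice f (τ m)) (fun m n f => by simp) (fun a m f => by simp)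
      (fun m f g => slice_add f g _) (fun a m f => slice_smul a f _))
  refine ⟨(coendRel R).liftQ g₀ (Submodule.span_le.2 ?_), ?_⟩
  · rintro _ ⟨r, hr, f, m, rfl⟩
    rw [SetLike.mem_coe, LinearMap.mem_ker, map_sub]
    refine sub_eq_zero.2 ?_
    change slice (f ∘ₗ r) (τ m) = slice f (τ (r m))
    rw [← slice_rTensor]
    exact (congrArg (slice f) (LinearMap.congr_fun (hτ r hr) m)).symm
  · ext m
    refine ext_of_slice fun f => ?_
    rw [LinearMap.comp_apply, slice_lTensor, hd]
    rfl

theorem Coend.coaction_comp {d : M →ₗ[k] M ⊗[k] Coend R}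
    (hd : ∀ f m, slice f (d m) = Coend.mk R f m) {r : Module.End k M} (hr : r ∈ R) :
    d ∘ₗ r = r.rTensor (Coend R) ∘ₗ d := by
  ext m
  refine ext_of_slice fun f => ?_
  rw [LinearMap.comp_apply, LinearMap.comp_apply, slice_rTensor, hd, hd, Coend.mk_comp hr]

/-- `M^* ⊗_R M` is a coalgebra, and `M` is a comodule over it. -/
theorem Coend.exists_coalgebra {d : M →ₗ[k] M ⊗[k] Coend R}
    (hd : ∀ f m, slice f (d m) = Coend.mk R f m) :
    ∃ _ : Coalgebra k (Coend R), IsComodule k d := by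
  obtain ⟨Δ, hΔ⟩ := Coend.exists_factor hd
    ((TensorProduct.assoc k M (Coend R) (Coend R)).toLinearMap ∘ₗ d.rTensor (Coend R) ∘ₗ d)
    fun r hr => by
      have h : (TensorProduct.assoc k M (Coend R) (Coend R)).toLinearMap ∘ₗ
          (r.rTensor (Coend R)).rTensor (Coend R) =
            r.rTensor _ ∘ₗ (TensorProduct.assoc k M (Coend R) (Coend R)).toLinearMap := by
        ext
        simp
      have h' : d.rTensor (Coend R) ∘ₗ r.rTensor (Coend R) =
          (r.rTensor (Coend R)).rTensor (Coend R) ∘ₗ d.rTensor (Coend R) := by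
        rw [← LinearMap.rTensor_comp, Coend.coaction_comp hd hr, LinearMap.rTensor_comp]
      rw [LinearMap.comp_assoc, LinearMap.comp_assoc, Coend.coaction_comp hd hr,
        ← LinearMap.comp_assoc d (r.rTensor _), h', ← LinearMap.comp_assoc (_ ∘ₗ d), ← h]
      rfl
  obtain ⟨ε, hε⟩ := Coend.exists_factor hd ((TensorProduct.mk k M k).flip 1) fun r hr => by
    ext
    simp
  exact exists_coalgebra_of_span (Coend.span_slice hd) hΔ hε

end Coend

/-- A partial comodule lifts to an `H^par`-comodule if it has a set `R` of endomorphisms of finite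
rank for which `R M` spans `M`. -/
theorem IsPartialComodule.exists_lift {k : Type u} [Field k] {H : Type v} [Ring H]
    [HopfAlgebra k H] {M : Type w} [AddCommGroup M] [Module k M] {ρ : M →ₗ[k] M ⊗[k] H}
    (hρ : IsPartialComodule k ρ) {R : Set (Module.End k M)}
    (hR : ∀ r ∈ R, ρ ∘ₗ r = r.rTensor H ∘ₗ ρ) (hfin : ∀ r ∈ R, ∃ t, finiteRankEnd M t = r)
    (hRM : Submodule.span k {x | ∃ r ∈ R, ∃ m : M, r m = x} = ⊤) :
    ∃ δ : M →ₗ[k] M ⊗[k] (Hpar k H).carrier,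
      IsComodule k δ ∧ (hparProj k H).lTensor M ∘ₗ δ = ρ := by
  obtain ⟨d, hd⟩ := Coend.exists_coaction hfin hRM
  obtain ⟨_, hdc⟩ := Coend.exists_coalgebra hd
  obtain ⟨ω, hω⟩ := Coend.exists_factor hd ρ hR
  rw [← hω] at hρ
  obtain ⟨g, hg⟩ := (hρ.isPartialCorep hdc (Coend.span_slice hd)).exists_lift
  refine ⟨_, hdc.push g, ?_⟩
  rw [← LinearMap.comp_assoc, ← LinearMap.lTensor_comp, hg, hω]

section Reconstruction

/-! ### Reconstruction of a coalgebra from its finite-dimensional comodules -/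

variable {k : Type*} [Field k] {C : Type*} [AddCommGroup C] [Module k C] [Coalgebra k C]

theorem Subcoalgebra.exists_finite_of_finset (s : Finset C) :
    ∃ X : Subcoalgebra k C, FiniteDimensional k X.carrier ∧ ∀ x ∈ s, x ∈ X.carrier := by
  classical
  induction s using Finset.induction_on with
  | empty =>
    obtain ⟨X, hX, -⟩ := Subcoalgebra.exists_finite (k := k) (0 : C)
    exact ⟨X, hX, by simp⟩
  | insert a s _ ih =>
    obtain ⟨X, hX, hs⟩ := ih
    obtain ⟨Y, hY, ha⟩ := Subcoalgebra.exists_finite (k := k) a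
    have h1 : X.carrier ≤ (Subcoalgebra.sum {X, Y}).carrier := le_iSup₂_of_le X (by simp) le_rfl
    have h2 : Y.carrier ≤ (Subcoalgebra.sum {X, Y}).carrier := le_iSup₂_of_le Y (by simp) le_rfl
    refine ⟨Subcoalgebra.sum {X, Y}, inferInstance, fun x hx => ?_⟩
    rcases Finset.mem_insert.1 hx with rfl | hx
    · exact h2 ha
    · exact h1 (hs x hx)

/-- Every finite-dimensional subspace of a coalgebra lies in a finite-dimensional subcoalgebra. -/
theorem Subcoalgebra.exists_finite_le (W : Submodule k C) [FiniteDimensional k W] :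
    ∃ X : Subcoalgebra k C, FiniteDimensional k X.carrier ∧ W ≤ X.carrier := by
  obtain ⟨s, rfl⟩ := (Submodule.fg_iff_finiteDimensional W).2 inferInstance
  obtain ⟨X, hX, h⟩ := Subcoalgebra.exists_finite_of_finset (k := k) s
  exact ⟨X, hX, Submodule.span_le.2 h⟩

theorem slice_counit_comul (c : C) :
    slice (Coalgebra.counit (R := k)) (Coalgebra.comul (R := k) c) = c := by
  rw [slice, LinearMap.comp_apply, Coalgebra.rTensor_counit_comul]
  simp

/-- The coefficient map `n ↦ ψ(n⁰) n¹` is a morphism of comodules `N → C`. -/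
theorem IsComodule.rTensor_slice {N : Type*} [AddCommGroup N] [Module k N]
    {δ : N →ₗ[k] N ⊗[k] C} (hδ : IsComodule k δ) (ψ : Module.Dual k N) :
    (slice ψ ∘ₗ δ).rTensor C ∘ₗ δ = Coalgebra.comul (R := k) ∘ₗ slice ψ ∘ₗ δ := by
  have h : slice ψ ∘ₗ (TensorProduct.assoc k N C C).toLinearMap = (slice ψ).rTensor C := by
    ext
    simp [smul_tmul']
  ext n
  have h' := congrArg (slice ψ) (LinearMap.congr_fun hδ.lTensor_comul n)
  rw [LinearMap.comp_apply, slice_lTensor] at h'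
  rw [LinearMap.rTensor_comp, ← h]
  exact h'.symm

theorem IsComodule.counit_slice {N : Type*} [AddCommGroup N] [Module k N]
    {δ : N →ₗ[k] N ⊗[k] C} (hδ : IsComodule k δ) (ψ : Module.Dual k N) :
    Coalgebra.counit (R := k) ∘ₗ slice ψ ∘ₗ δ = ψ := by
  ext n
  rw [LinearMap.comp_apply, LinearMap.comp_apply, ← slice_lTensor, hδ.lTensor_counit]
  simp

/-- The regular coaction of a subcoalgebra `X`, corestricted to `C`. -/
def Subcoalgebra.coact (X : Subcoalgebra k C) : X.carrier →ₗ[k] X.carrier ⊗[k] C :=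
  X.incl.toLinearMap.lTensor X.carrier ∘ₗ Coalgebra.comul (R := k)

theorem Subcoalgebra.isComodule_coact (X : Subcoalgebra k C) : IsComodule k X.coact :=
  isComodule_comul.push X.incl

theorem Subcoalgebra.rTensor_subtype_coact (X : Subcoalgebra k C) :
    X.carrier.subtype.rTensor C ∘ₗ X.coact = Coalgebra.comul (R := k) ∘ₗ X.carrier.subtype := by
  rw [coact, ← LinearMap.comp_assoc, LinearMap.rTensor_comp_lTensor]
  exact X.incl.map_comp_comul

/-- A morphism of comodules `N → C` with values in `X` is one to `X`. -/
theorem Subcoalgebra.colinear_codRestrict (X : Subcoalgebra k C) {N : Type*} [AddCommGroup N]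
    [Module k N] {δ : N →ₗ[k] N ⊗[k] C} {j : N →ₗ[k] C}
    (hj : j.rTensor C ∘ₗ δ = Coalgebra.comul (R := k) ∘ₗ j) (h : ∀ n, j n ∈ X.carrier) :
    X.coact ∘ₗ j.codRestrict X.carrier h = (j.codRestrict X.carrier h).rTensor C ∘ₗ δ := by
  have hinj : Function.Injective (X.carrier.subtype.rTensor C) :=
    Module.Flat.rTensor_preserves_injective_linearMap _ X.carrier.subtype_injective
  rw [← LinearMap.cancel_left hinj, ← LinearMap.comp_assoc, X.rTensor_subtype_coact,
    ← LinearMap.comp_assoc, ← LinearMap.rTensor_comp, LinearMap.comp_assoc,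
    LinearMap.subtype_comp_codRestrict, hj]

/-- A coalgebra is reconstructed from its finite-dimensional comodules. Let `(Nᵢ, δᵢ)` be a family
of finite-dimensional comodules that contains, up to isomorphism, all finite-dimensional
subcoalgebras. A family of maps `τᵢ : Nᵢ → Nᵢ ⊗ V` natural for all morphisms of comodules is
`(I ⊗ g) ∘ δᵢ` for a unique `g : C → V`; on a finite-dimensional subcoalgebra `X`, this is
`g = (ε ⊗ I) ∘ τ_X`. -/
theorem existsUnique_of_natural {ι : Type*} {N : ι → Type*} [∀ i, AddCommGroup (N i)]
    [∀ i, Module k (N i)] [∀ i, FiniteDimensional k (N i)] {δ : ∀ i, N i →ₗ[k] N i ⊗[k] C}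
    (hδ : ∀ i, IsComodule k (δ i))
    (hN : ∀ X : Subcoalgebra k C, FiniteDimensional k X.carrier →
      ∃ i, ∃ e : X.carrier ≃ₗ[k] N i, δ i ∘ₗ e.toLinearMap = e.toLinearMap.rTensor C ∘ₗ X.coact)
    {V : Type*} [AddCommGroup V] [Module k V] (τ : ∀ i, N i →ₗ[k] N i ⊗[k] V)
    (hτ : ∀ i i' (f : N i →ₗ[k] N i'), δ i' ∘ₗ f = f.rTensor C ∘ₗ δ i →
      τ i' ∘ₗ f = f.rTensor V ∘ₗ τ i) :
    ∃! g : C →ₗ[k] V, ∀ i, g.lTensor (N i) ∘ₗ δ i = τ i := by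
  -- Replace `X` by the corresponding `Nᵢ`, with an embedding `j` into `C` whose range is `X`.
  have hN' : ∀ X : Subcoalgebra k C, FiniteDimensional k X.carrier →
      ∃ (i : ι) (j : N i →ₗ[k] C), Function.Injective j ∧ LinearMap.range j = X.carrier ∧
        j.rTensor C ∘ₗ δ i = Coalgebra.comul (R := k) ∘ₗ j ∧
        ∀ i' (j' : N i' →ₗ[k] C), j'.rTensor C ∘ₗ δ i' = Coalgebra.comul (R := k) ∘ₗ j' →
          (∀ n, j' n ∈ X.carrier) → ∃ f : N i' →ₗ[k] N i,
            δ i ∘ₗ f = f.rTensor C ∘ₗ δ i' ∧ j ∘ₗ f = j' := by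
    intro X hX
    obtain ⟨i, e, he⟩ := hN X hX
    have he' : δ i = e.toLinearMap.rTensor C ∘ₗ X.coact ∘ₗ e.symm.toLinearMap := by
      rw [← LinearMap.comp_assoc, ← he, LinearMap.comp_assoc, LinearEquiv.comp_symm,
        LinearMap.comp_id]
    refine ⟨i, X.carrier.subtype ∘ₗ e.symm.toLinearMap,
      X.carrier.subtype_injective.comp e.symm.injective, ?_, ?_, ?_⟩
    · rw [LinearMap.range_comp_of_range_eq_top _ (LinearEquiv.range _), Submodule.range_subtype]
    · rw [he', ← LinearMap.comp_assoc, ← LinearMap.rTensor_comp, LinearMap.comp_assoc _ _ _,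
        LinearEquiv.symm_comp, LinearMap.comp_id, ← LinearMap.comp_assoc, X.rTensor_subtype_coact]
      rfl
    · intro i' j' hj' hn
      refine ⟨e.toLinearMap ∘ₗ j'.codRestrict X.carrier hn, ?_, ?_⟩
      · rw [← LinearMap.comp_assoc, he, LinearMap.comp_assoc, X.colinear_codRestrict hj' hn,
          LinearMap.rTensor_comp]
        rfl
      · ext n
        simp
  -- The value of `g` at `j n`, for a morphism of comodules `j : Nᵢ → C`.
  let β : ∀ i, (N i →ₗ[k] C) → N i →ₗ[k] V := fun i j =>
    slice (Coalgebra.counit (R := k) ∘ₗ j) ∘ₗ τ i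
  have hβ : ∀ i i' (j : N i →ₗ[k] C) (j' : N i' →ₗ[k] C) (f : N i →ₗ[k] N i'),
      δ i' ∘ₗ f = f.rTensor C ∘ₗ δ i → j' ∘ₗ f = j → ∀ n, β i' j' (f n) = β i j n := by
    rintro i i' _ j' f hf rfl n
    have h := LinearMap.congr_fun (hτ i i' f hf) n
    simp only [LinearMap.comp_apply] at h
    simp only [β, LinearMap.comp_apply, h, slice_rTensor]
    rfl
  -- This value depends only on `j n`: two morphisms of comodules `j`, `j'` factor through a common
  -- finite-dimensional subcoalgebra.
  have hwd : ∀ i i' (j : N i →ₗ[k] C) (j' : N i' →ₗ[k] C),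
      j.rTensor C ∘ₗ δ i = Coalgebra.comul (R := k) ∘ₗ j →
      j'.rTensor C ∘ₗ δ i' = Coalgebra.comul (R := k) ∘ₗ j' →
      ∀ n n', j n = j' n' → β i j n = β i' j' n' := by
    intro i i' j j' hj hj' n n' h
    obtain ⟨X, hX, hle⟩ :=
      Subcoalgebra.exists_finite_le (LinearMap.range j ⊔ LinearMap.range j')
    obtain ⟨a, q, hq, -, -, hlift⟩ := hN' X hX
    obtain ⟨f, hf, hqf⟩ := hlift i j hj fun n => hle (Submodule.mem_sup_left ⟨n, rfl⟩)
    obtain ⟨f', hf', hqf'⟩ := hlift i' j' hj' fun n => hle (Submodule.mem_sup_right ⟨n, rfl⟩)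
    have hff : f n = f' n' := hq (by
      rw [← LinearMap.comp_apply, ← LinearMap.comp_apply, hqf, hqf', h])
    rw [← hβ i a j q f hf hqf n, ← hβ i' a j' q f' hf' hqf' n', hff]
  have hex : ∀ c : C, ∃ (i : ι) (j : N i →ₗ[k] C) (n : N i),
      j.rTensor C ∘ₗ δ i = Coalgebra.comul (R := k) ∘ₗ j ∧ j n = c := by
    intro c
    obtain ⟨X, hX, hc⟩ := Subcoalgebra.exists_finite (k := k) c
    obtain ⟨i, j, -, hr, hj, -⟩ := hN' X hX
    obtain ⟨n, hn⟩ := hr.symm ▸ hc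
    exact ⟨i, j, n, hj, hn⟩
  choose i₀ j₀ n₀ hj₀ hn₀ using hex
  have hg : ∀ i (j : N i →ₗ[k] C), j.rTensor C ∘ₗ δ i = Coalgebra.comul (R := k) ∘ₗ j →
      ∀ n, β (i₀ (j n)) (j₀ (j n)) (n₀ (j n)) = β i j n := fun i j hj n =>
    hwd _ _ _ _ (hj₀ _) hj _ _ (hn₀ _)
  let g : C →ₗ[k] V :=
    { toFun := fun c => β (i₀ c) (j₀ c) (n₀ c)
      map_add' := fun c c' => by
        classical
        obtain ⟨X, hX, hc⟩ := Subcoalgebra.exists_finite_of_finset (k := k) {c, c'}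
        obtain ⟨i, j, -, hr, hj, -⟩ := hN' X hX
        obtain ⟨n, rfl⟩ := hr.symm ▸ hc c (by simp)
        obtain ⟨n', rfl⟩ := hr.symm ▸ hc c' (by simp)
        rw [← map_add, hg i j hj, hg i j hj, hg i j hj, map_add]
      map_smul' := fun a c => by
        obtain ⟨X, hX, hc⟩ := Subcoalgebra.exists_finite (k := k) c
        obtain ⟨i, j, -, hr, hj, -⟩ := hN' X hX
        obtain ⟨n, rfl⟩ := hr.symm ▸ hc
        rw [← map_smul, hg i j hj, hg i j hj, map_smul, RingHom.id_apply] }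
  refine ⟨g, fun i => ?_, fun g' hg' => ?_⟩
  · ext n
    refine ext_of_slice fun ψ => ?_
    rw [LinearMap.comp_apply, slice_lTensor]
    refine (hg i (slice ψ ∘ₗ δ i) ((hδ i).rTensor_slice ψ) n).trans ?_
    simp only [β, LinearMap.comp_apply, (hδ i).counit_slice]
  · ext c
    have h := congrArg (slice (Coalgebra.counit (R := k) ∘ₗ j₀ c))
      (LinearMap.congr_fun (hg' (i₀ c)) (n₀ c))
    have h' := LinearMap.congr_fun (hj₀ c) (n₀ c)
    rw [LinearMap.comp_apply, LinearMap.comp_apply, hn₀] at h'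
    rw [LinearMap.comp_apply, slice_lTensor, ← slice_rTensor, h', slice_counit_comul] at h
    exact h

end Reconstruction

section Firm

/-! ### Firmly projective and finite-dimensional partial comodules -/

/-- Over a ring with a left unit that acts as the identity, every `r ⊗ m` is `e ⊗ r m`. -/
theorem isFirmModule_of_unit {R : Type*} [NonUnitalRing R] {M : Type*} [AddCommGroup M]
    (act : R →ₙ+* AddMonoid.End M) (e : R) (he : ∀ r, e * r = r) (hact : ∀ m, act e m = m) :
    IsFirmModule act := by
  have hmk : ∀ z : R ⊗[ℤ] M, z - e ⊗ₜ[ℤ] actionMap act z ∈ balancedRel act := by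
    intro z
    induction z with
    | zero => simp
    | add a b ha hb =>
      have h := add_mem ha hb
      rwa [sub_add_sub_comm, ← tmul_add, ← map_add] at h
    | tmul r m =>
      refine AddSubgroup.subset_closure ⟨e, r, m, ?_⟩
      rw [he]
      rfl
  refine ⟨(injective_iff_map_eq_zero _).2 fun x hx => ?_, fun m => ?_⟩
  · obtain ⟨z, rfl⟩ := QuotientAddGroup.mk_surjective x
    have hz : actionMap act z = 0 := hx
    have h := hmk z
    rw [hz, tmul_zero, sub_zero] at h
    exact (QuotientAddGroup.eq_zero_iff z).2 h
  · exact ⟨QuotientAddGroup.mk (e ⊗ₜ[ℤ] m), hact m⟩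

theorem IsFirmModule.closure_eq_top {R : Type*} [NonUnitalRing R] {M : Type*} [AddCommGroup M]
    {act : R →ₙ+* AddMonoid.End M} (h : IsFirmModule act) :
    AddSubgroup.closure {x | ∃ r m, act r m = x} = ⊤ := by
  refine (AddSubgroup.eq_top_iff' _).2 fun m => ?_
  obtain ⟨x, rfl⟩ := h.2 m
  obtain ⟨z, rfl⟩ := QuotientAddGroup.mk_surjective x
  change actionMap act z ∈ _
  induction z with
  | zero => simp
  | add a b ha hb => rw [map_add]; exact add_mem ha hb
  | tmul r m => exact AddSubgroup.subset_closure ⟨r, m, rfl⟩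

variable {k : Type u} [Field k]

/-- The ring of endomorphisms of `(M, ρ)`. -/
def Coaction.endSubring {D : Type v} [AddCommGroup D] [Module k D] (M : Coaction.{u, v, w} k D) :
    NonUnitalSubring (Module.End k M.carrier) where
  carrier := {r | M.coact ∘ₗ r = r.rTensor D ∘ₗ M.coact}
  zero_mem' := by
    change M.coact ∘ₗ (0 : M.carrier →ₗ[k] M.carrier) = LinearMap.rTensor D 0 ∘ₗ M.coact
    rw [LinearMap.rTensor_zero, LinearMap.comp_zero, LinearMap.zero_comp]
  add_mem' {r s} hr hs := by
    change M.coact ∘ₗ (r + s) = (r + s).rTensor D ∘ₗ M.coact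
    rw [LinearMap.rTensor_add, LinearMap.comp_add, LinearMap.add_comp]
    exact congrArg₂ (· + ·) hr hs
  neg_mem' {r} hr := by
    change M.coact ∘ₗ (-r) = (-r).rTensor D ∘ₗ M.coact
    rw [LinearMap.rTensor_neg, LinearMap.comp_neg, LinearMap.neg_comp]
    exact congrArg (- ·) hr
  mul_mem' {r s} hr hs := by
    change M.coact ∘ₗ r ∘ₗ s = (r ∘ₗ s).rTensor D ∘ₗ M.coact
    rw [← LinearMap.comp_assoc, show M.coact ∘ₗ r = _ from hr, LinearMap.comp_assoc,
      show M.coact ∘ₗ s = _ from hs, LinearMap.rTensor_comp]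
    rfl

/-- A finite-dimensional `(M, ρ)` is firmly projective, for its ring of all endomorphisms. -/
theorem Coaction.isFirmlyProjective_of_finiteDimensional {D : Type v} [AddCommGroup D] [Module k D]
    (M : Coaction.{u, v, w} k D) [FiniteDimensional k M.carrier] : M.IsFirmlyProjective := by
  have hbij : Function.Bijective (finiteRankEnd (k := k) M.carrier) :=
    (dualTensorHomEquiv k M.carrier M.carrier).bijective.comp (TensorProduct.comm k _ _).bijective
  let E := LinearEquiv.ofBijective _ hbij
  have hE : ∀ r, finiteRankEnd M.carrier (E.symm r) = r := E.apply_symm_apply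
  let e : M.endSubring := ⟨1, by
    change M.coact ∘ₗ LinearMap.id = LinearMap.rTensor D LinearMap.id ∘ₗ M.coact
    rw [LinearMap.rTensor_id]
    rfl⟩
  have he : ∀ r, e * r = r := fun r => Subtype.ext (one_mul r.1)
  let φ : M.endSubring →+ M.carrier ⊗[k] Module.Dual k M.carrier :=
    E.symm.toLinearMap.toAddMonoidHom.comp (NonUnitalSubringClass.subtype M.endSubring : _ →+ _)
  have hφ : ∀ r, finiteRankEnd M.carrier (φ r) = r := fun r => hE r.1
  refine ⟨M.endSubring, fun r hr => hr, isFirmModule_of_unit _ e he he, φ,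
    ⟨fun r s => hbij.1 ?_, isFirmModule_of_unit _ e he fun m => ?_⟩, hφ⟩
  · rw [finiteRankEnd_mul, hφ, hφ, hφ]
    rfl
  · exact LinearMap.congr_fun (hφ e) m

/-- A firmly projective partial comodule lifts to an `H^par`-comodule. -/
theorem Coaction.IsFirmlyProjective.exists_lift {H : Type v} [Ring H] [HopfAlgebra k H]
    {M : Coaction.{u, v, w} k H} (hM : M.IsFirmlyProjective) (hρ : IsPartialComodule k M.coact) :
    ∃ δ : M.carrier →ₗ[k] M.carrier ⊗[k] (Hpar k H).carrier,
      IsComodule k δ ∧ (hparProj k H).lTensor M.carrier ∘ₗ δ = M.coact := by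
  obtain ⟨R, hR, -, φ, ⟨hmul, hfirm⟩, hφ⟩ := hM
  refine hρ.exists_lift (R := R) hR (fun r hr => ⟨φ ⟨r, hr⟩, hφ _⟩) ?_
  refine Submodule.eq_top_iff'.2 fun m => ?_
  have hm : m ∈ AddSubgroup.closure {x | ∃ r m, inducedAction φ hmul r m = x} :=
    hfirm.closure_eq_top ▸ AddSubgroup.mem_top m
  suffices h : AddSubgroup.closure {x | ∃ r m, inducedAction φ hmul r m = x} ≤
      (Submodule.span k {x | ∃ r ∈ (R : Set (Module.End k M.carrier)), ∃ m, r m = x}).toAddSubgroup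
    from h hm
  refine (AddSubgroup.closure_le _).2 ?_
  rintro _ ⟨r, m, rfl⟩
  refine Submodule.subset_span ⟨r, r.2, m, ?_⟩
  rw [← hφ]
  rfl

/-- Firm projectivity passes to another coaction on `M` with at least as many endomorphisms. -/
theorem Coaction.IsFirmlyProjective.of_colinear {M : Type w} [AddCommGroup M] [Module k M]
    {D : Type v} [AddCommGroup D] [Module k D] {D' : Type w'} [AddCommGroup D'] [Module k D']
    {ρ : M →ₗ[k] M ⊗[k] D} {ρ' : M →ₗ[k] M ⊗[k] D'}
    (h : ∀ r : M →ₗ[k] M, ρ ∘ₗ r = r.rTensor D ∘ₗ ρ → ρ' ∘ₗ r = r.rTensor D' ∘ₗ ρ')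
    (hM : (Coaction.mk (k := k) M ρ).IsFirmlyProjective) :
    (Coaction.mk (k := k) M ρ').IsFirmlyProjective := by
  obtain ⟨R, hR, hM⟩ := hM
  exact ⟨R, fun r hr => h r (hR r hr), hM⟩

end Firm

section Gamma

/-! ### The functor from comodules to partial comodules -/

variable {k : Type u} [Field k] {H : Type v} [Ring H] [HopfAlgebra k H]
  (h : ∀ M : Coaction.{u, max u v, w} k (Hpar k H).carrier, IsComodule k M.coact →
      IsPartialComodule k ((Coaction.push (hparProj k H)).obj M).coact)

theorem gamma_full : (Gamma k H h).Full where
  map_surjective {M N} f := by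
    refine ⟨ObjectProperty.homMk ⟨f.hom.toLin, ?_⟩, rfl⟩
    exact colinear_of_colinear_hparProj M.property N.property f.hom.toLin f.hom.colinear

theorem gamma_faithful : (Gamma k H h).Faithful where
  map_injective {M N} f g hfg := by
    apply ObjectProperty.hom_ext
    refine Coaction.Hom.ext ?_
    exact congrArg (fun t => t.hom.toLin) hfg

/-- Distinct `H^par`-comodules have distinct partial comodules, as the coaction of `H^par` is
determined by that of `H`. -/
theorem gamma_obj_injective : Function.Injective (Gamma k H h).obj := by
  rintro ⟨⟨M, ρ⟩, hM⟩ ⟨⟨N, σ⟩, hN⟩ heq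
  have heq' := congrArg ObjectProperty.FullSubcategory.obj heq
  change Coaction.mk M _ = Coaction.mk N _ at heq'
  injection heq' with h1 h2 h3 h4
  subst h1
  obtain rfl := eq_of_heq h2
  obtain rfl := eq_of_heq h3
  obtain rfl := eq_of_lTensor_hparProj_eq hM hN (eq_of_heq h4)
  rfl

/-- `Γ` restricts to an isomorphism between full subcategories if every object of the second
lifts to one of the first. -/
theorem isIsoOfCategories_restrict_gamma
    (P : ObjectProperty (ComoduleCat.{u, max u v, w} k (Hpar k H).carrier))
    (Q : ObjectProperty (PartialComoduleCat.{u, v, w} k H))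
    (hPQ : ∀ M, P M → Q ((Gamma k H h).obj M))
    (hlift : ∀ N, Q N → ∃ M, P M ∧ (Gamma k H h).obj M = N) :
    IsIsoOfCategories (restrictFunctor (Gamma k H h) P Q hPQ) := by
  have := gamma_full h
  have := gamma_faithful h
  have : (restrictFunctor (Gamma k H h) P Q hPQ).Full :=
    inferInstanceAs (Q.lift (P.ι ⋙ Gamma k H h) _).Full
  have : (restrictFunctor (Gamma k H h) P Q hPQ).Faithful :=
    inferInstanceAs (Q.lift (P.ι ⋙ Gamma k H h) _).Faithful
  refine isIsoOfCategories_of_bijective _ ⟨?_, ?_⟩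
  · rintro ⟨M, hM⟩ ⟨N, hN⟩ heq
    obtain rfl := gamma_obj_injective h (congrArg ObjectProperty.FullSubcategory.obj heq)
    rfl
  · rintro ⟨N, hN⟩
    obtain ⟨M, hM, rfl⟩ := hlift N hN
    exact ⟨⟨M, hM⟩, rfl⟩

/-- Every firmly projective partial comodule is the image of a firmly projective
`H^par`-comodule. -/
theorem exists_gamma_obj_eq (N : PartialComoduleCat.{u, v, w} k H) (hN : N.obj.IsFirmlyProjective) :
    ∃ M : ComoduleCat.{u, max u v, w} k (Hpar k H).carrier,
      M.obj.IsFirmlyProjective ∧ (Gamma k H h).obj M = N := by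
  obtain ⟨⟨N, ρ⟩, hρ⟩ := N
  obtain ⟨δ, hδ, rfl⟩ : ∃ δ : N →ₗ[k] N ⊗[k] (Hpar k H).carrier,
      IsComodule k δ ∧ (hparProj k H).lTensor N ∘ₗ δ = ρ := hN.exists_lift hρ
  exact ⟨⟨⟨N, δ⟩, hδ⟩,
    hN.of_colinear fun r hr => colinear_of_colinear_hparProj hδ hδ r hr, rfl⟩

end Gamma

section Tannaka

/-! ### Reconstruction of the universal corep-coalgebra -/

variable {k : Type u} [Field k] {H : Type v} [Ring H] [HopfAlgebra k H]

theorem exists_linearEquiv_ulift (V : Type*) [AddCommGroup V] [Module k V]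
    [FiniteDimensional k V] : ∃ n : ℕ, Nonempty (V ≃ₗ[k] ULift.{w} (Fin n → k)) :=
  ⟨_, ⟨(Module.finBasis k V).equivFun.trans ULift.moduleEquiv.symm⟩⟩

/-- Every finite-dimensional subcoalgebra of `H^par` is, as a comodule, isomorphic to one on a
power of `k` in the universe of the fibre functor. -/
theorem exists_finPartialComodule_equiv
    {δ : ∀ N : FinPartialComoduleCat.{u, v, max u w} k H,
      N.obj.obj.carrier →ₗ[k] N.obj.obj.carrier ⊗[k] (Hpar k H).carrier}
    (hδ : ∀ N, IsComodule k (δ N))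
    (hp : ∀ N, (hparProj k H).lTensor N.obj.obj.carrier ∘ₗ δ N = N.obj.obj.coact)
    (X : Subcoalgebra k (Hpar k H).carrier) (hX : FiniteDimensional k X.carrier) :
    ∃ (N : FinPartialComoduleCat.{u, v, max u w} k H) (e : X.carrier ≃ₗ[k] N.obj.obj.carrier),
      δ N ∘ₗ e.toLinearMap = e.toLinearMap.rTensor _ ∘ₗ X.coact := by
  obtain ⟨n, ⟨e⟩⟩ := exists_linearEquiv_ulift.{u, w} (k := k) X.carrier
  have hc := X.isComodule_coact.congr e
  let N : FinPartialComoduleCat.{u, v, max u w} k H :=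
    ⟨⟨⟨ULift.{w} (Fin n → k),
      (hparProj k H).lTensor _ ∘ₗ e.toLinearMap.rTensor _ ∘ₗ X.coact ∘ₗ e.symm.toLinearMap⟩,
      (isPartialCorep_hparProj k H).isPartialComodule_push hc⟩,
      Module.Finite.equiv e⟩
  refine ⟨N, e, ?_⟩
  have h : δ N = e.toLinearMap.rTensor _ ∘ₗ X.coact ∘ₗ e.symm.toLinearMap :=
    eq_of_lTensor_hparProj_eq (hδ N) hc (hp N)
  rw [h]
  ext x
  simp

/-- `H^par` is the coend of the fibre functor: a finite-dimensional partial comodule is the same as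
a finite-dimensional `H^par`-comodule, with the same morphisms. -/
theorem isTannakaReconstruction_hpar
    {δ : ∀ N : FinPartialComoduleCat.{u, v, max u w} k H,
      N.obj.obj.carrier →ₗ[k] N.obj.obj.carrier ⊗[k] (Hpar k H).carrier}
    (hδ : ∀ N, IsComodule k (δ N))
    (hp : ∀ N, (hparProj k H).lTensor N.obj.obj.carrier ∘ₗ δ N = N.obj.obj.coact) :
    IsTannakaReconstruction.{u, max u v, max u w, w'} (fibreFunctor.{u, v, max u w} k H)
      (Hpar k H).carrier δ where
  isComodule := hδ
  natural {X Y} f := by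
    refine colinear_of_colinear_hparProj (hδ X) (hδ Y) f.hom.hom.toLin ?_
    rw [hp, hp]
    exact f.hom.hom.colinear
  universal V _ _ τ hτ := by
    have : ∀ N : FinPartialComoduleCat.{u, v, max u w} k H,
        FiniteDimensional k N.obj.obj.carrier := fun N => N.property
    refine existsUnique_of_natural hδ (exists_finPartialComodule_equiv hδ hp) τ fun X Y f hf => ?_
    have hf' : Y.obj.obj.coact ∘ₗ f = f.rTensor H ∘ₗ X.obj.obj.coact := by
      rw [← hp, ← hp, LinearMap.comp_assoc, hf, ← LinearMap.comp_assoc, ← LinearMap.comp_assoc,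
        LinearMap.lTensor_comp_rTensor, LinearMap.rTensor_comp_lTensor]
    let F : X ⟶ Y := ObjectProperty.homMk (ObjectProperty.homMk ⟨f, hf'⟩)
    exact hτ F

end Tannaka

end

end PartialComodule

theorem mainTheorem1 (k : Type u) [Field k] (H : Type v) [Ring H] [HopfAlgebra k H] :
    ∃ h : ∀ M : Coaction.{u, max u v, max u w} k (Hpar k H).carrier, IsComodule k M.coact →
        IsPartialComodule k ((hparProj k H).lTensor M.carrier ∘ₗ M.coact),
      ((Gamma k H h).Full ∧ (Gamma k H h).Faithful) ∧
      (∃ hf : ∀ M, M.obj.IsFirmlyProjective → ((Gamma k H h).obj M).obj.IsFirmlyProjective,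
        IsIsoOfCategories (restrictFunctor (Gamma k H h)
          (fun M => M.obj.IsFirmlyProjective) (fun N => N.obj.IsFirmlyProjective) hf)) ∧
      (∃ hfd : ∀ M, FiniteDimensional k M.obj.carrier →
          FiniteDimensional k ((Gamma k H h).obj M).obj.carrier,
        IsIsoOfCategories (restrictFunctor (Gamma k H h)
          (fun M => FiniteDimensional k M.obj.carrier)
          (fun N => FiniteDimensional k N.obj.carrier) hfd)) ∧
      (∃ δ : ∀ N : FinPartialComoduleCat.{u, v, max u w} k H,
          N.obj.obj.carrier →ₗ[k] N.obj.obj.carrier ⊗[k] (Hpar k H).carrier,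
        (∀ N, (hparProj k H).lTensor N.obj.obj.carrier ∘ₗ δ N = N.obj.obj.coact) ∧
        IsTannakaReconstruction.{u, max u v, max u w, w'}
          (fibreFunctor.{u, v, max u w} k H) (Hpar k H).carrier δ) := by
  have h : ∀ M : Coaction.{u, max u v, max u w} k (Hpar k H).carrier, IsComodule k M.coact →
      IsPartialComodule k ((hparProj k H).lTensor M.carrier ∘ₗ M.coact) := fun M hM =>
    (isPartialCorep_hparProj k H).isPartialComodule_push hM
  have hf : ∀ M, M.obj.IsFirmlyProjective → ((Gamma k H h).obj M).obj.IsFirmlyProjective :=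
    fun M hM => hM.of_colinear fun r hr =>
      ((Coaction.push (hparProj k H)).map (X := M.obj) (Y := M.obj) ⟨r, hr⟩).colinear
  refine ⟨h, ⟨gamma_full h, gamma_faithful h⟩,
    ⟨hf, isIsoOfCategories_restrict_gamma h _ _ hf (exists_gamma_obj_eq h)⟩,
    ⟨fun M hM => hM, isIsoOfCategories_restrict_gamma h _ _ _ fun N hN => ?_⟩, ?_⟩
  · have : FiniteDimensional k N.obj.carrier := hN
    obtain ⟨M, -, rfl⟩ := exists_gamma_obj_eq h N N.obj.isFirmlyProjective_of_finiteDimensional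
    exact ⟨M, hN, rfl⟩
  · have hex : ∀ N : FinPartialComoduleCat.{u, v, max u w} k H,
        ∃ δ : N.obj.obj.carrier →ₗ[k] N.obj.obj.carrier ⊗[k] (Hpar k H).carrier,
          IsComodule k δ ∧ (hparProj k H).lTensor N.obj.obj.carrier ∘ₗ δ = N.obj.obj.coact := by
      intro N
      have : FiniteDimensional k N.obj.obj.carrier := N.property
      exact N.obj.obj.isFirmlyProjective_of_finiteDimensional.exists_lift N.obj.property
    choose δ hδ hp using hex
    exact ⟨δ, hp, isTannakaReconstruction_hpar hδ hp⟩
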